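/- All manifolds are smooth, real, second-countable, Hausdorff and without boundary; maps between manifolds are smooth unless said otherwise. **Orbifolds.** Let $Q$ be a topological space. A *(reduced) orbifold chart* of dimension $n$ on $Q$ is a triple $(V,G,\pi)$, where $V$ is a connected $n$-manifold, $G$ is a finite subgroup of $\mathrm{Diff}(V)$, and $\pi\colon V\to Q$ is a map with open image which induces a homeomorphism $G\backslash V\to\pi(V)$. Charts $(V,G,\pi)$ and $(W,H,\chi)$ are *compatible* if for all $x\in V$, $y\in W$ with $\pi(x)=\chi(y)$ there is a diffeomorphism $h$ from an open neighbourhood of $x$ onto an open neighbourhood of $y$ with $\chi\circ h=\pi$ and $h(x)=y$. An *open embedding* of charts $(V,G,\pi)\to(W,H,\chi)$ is an open embedding of manifolds $\mu\colon V\to W$ with $\chi\circ\mu=\pi$. An *orbifold* of dimension $n$ is a pair $(Q,\mathcal U)$, where $Q$ is a second-countable Hausdorff space and $\mathcal U$ is a maximal collection of pairwise compatible orbifold charts of dimension $n$ whose images cover $Q$. A *representing atlas* of $\mathcal U$ is an indexed family $\mathcal V=\{(V_i,G_i,\pi_i)\}_{i\in I}$ of charts in $\mathcal U$ whose images cover $Q$;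 members with different indices count as different charts. For such $\mathcal V$ put $V=\coprod_i V_i$, $\pi=\coprod_i\pi_i$. A *transition* on a manifold is a diffeomorphism between open subsets of it, and $\Psi(\mathcal V)$ is the set of all transitions $h$ on $V$ with $\pi\circ h=\pi|_{\operatorname{dom}h}$. A *change of charts* of $\mathcal V$ is an $h\in\Psi(\mathcal V)$ whose domain is a nonempty open subset of some $V_i$ and whose image lies in some $V_j$. **Charted orbifold maps.** Let $(Q,\mathcal U)$, $(Q',\mathcal U')$ be orbifolds (of possibly different dimensions) and let $\mathcal V=\{(V_i,G_i,\pi_i)\}_{i\in I}$, $\mathcal V'=\{(V'_j,G'_j,\pi'_j)\}_{j\in J}$ be representing atlases of $\mathcal U$, $\mathcal U'$, with $V'=\coprod_jV'_j$ and $\pi'=\coprod_j\pi'_j$. A *representative* of an orbifold map with $(\mathcal V,\mathcal V')$ is a tuple $(f,\{\tilde f_i\}_{i\in I},P,\nu)$ such that 1. $f\colon Q\to Q'$ is continuous; 2. for each $i\in I$, $\tilde f_i\colon V_i\to V'_{j}$ (for some $j=j(i)\in J$) is smooth with $\pi'_{j}\circ\tilde f_i=f\circ\pi_i$; put $\psi=\coprod_i\tilde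 f_i\colon V\to V'$; 3. $P$ is a set of changes of charts of $\mathcal V$ which is a quasi-pseudogroup (for $\lambda,\mu\in P$, every germ of $\lambda^{-1}$ and every germ of $\mu\circ\lambda$, wherever defined, is the germ of an element of $P$) and generates $\Psi(\mathcal V)$ (every germ of an element of $\Psi(\mathcal V)$ is the germ of an element of $P$); 4. $\nu$ assigns to each $\lambda\in P$ an element $\nu(\lambda)\in\Psi(\mathcal V')$ which is an open embedding between charts of $\mathcal U'$ (its domain is an open subset of some $V'_j$ which, with the restriction of $\pi'_j$ and a suitable group, is a chart in $\mathcal U'$, and its image lies in some $V'_k$), such that (a) $\psi\circ\lambda=\nu(\lambda)\circ\psi|_{\operatorname{dom}\lambda}$ (in particular $\psi(\operatorname{dom}\lambda)\subseteq\operatorname{dom}\nu(\lambda)$); (b) if $\operatorname{germ}_x\lambda=\operatorname{germ}_x\mu$ with $\lambda,\mu\in P$, then $\operatorname{germ}_{\psi(x)}\nu(\lambda)=\operatorname{germ}_{\psi(x)}\nu(\mu)$; (c) if $\lambda,\mu,h\in P$ and $\operatorname{germ}_x(\mu\circ\lambda)=\operatorname{germ}_xh$, then $\operatorname{germ}_{\psi(\lambda(x))}\nu(\mu)\cdot\operatorname{germ}_{\psi(x)}\nu(\lambda)=\operatorname{germ}_{\psi(x)}\nu(h)$;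 (d) if $\lambda\in P$ and $\operatorname{germ}_x\lambda=\operatorname{germ}_x\mathrm{id}$, then $\operatorname{germ}_{\psi(x)}\nu(\lambda)=\operatorname{germ}_{\psi(x)}\mathrm{id}$. Two representatives $(f,\{\tilde f_i\},P_1,\nu_1)$, $(g,\{\tilde g_i\},P_2,\nu_2)$ with $(\mathcal V,\mathcal V')$ are identified if $f=g$, $\tilde f_i=\tilde g_i$ for all $i$, and $\operatorname{germ}_{\psi(x)}\nu_1(\lambda_1)=\operatorname{germ}_{\psi(x)}\nu_2(\lambda_2)$ whenever $\lambda_1\in P_1$, $\lambda_2\in P_2$ and $\operatorname{germ}_x\lambda_1=\operatorname{germ}_x\lambda_2$. The resulting equivalence classes are the *charted orbifold maps* with $(\mathcal V,\mathcal V')$; they form the set $\mathrm{Orb}(\mathcal V,\mathcal V')$. **Composition and lifts of the identity.** The composition $\hat g\circ\hat f\in\mathrm{Orb}(\mathcal V,\mathcal V'')$ of $\hat f\in\mathrm{Orb}(\mathcal V,\mathcal V')$ and $\hat g\in\mathrm{Orb}(\mathcal V',\mathcal V'')$ has underlying map $g\circ f$ and local lifts $\tilde g_{j(i)}\circ\tilde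 f_i$. Its pair $(P,\nu)$ consists of all changes of charts $\lambda$ of $\mathcal V$ for which there are $\mu\in P_f$ and $\xi\in P_g$ such that $\lambda$ is a restriction of $\mu$, $\psi_f(\operatorname{dom}\lambda)\subseteq\operatorname{dom}\xi$, and $\nu_f(\mu)$ and $\xi$ have the same germ at each point of $\psi_f(\operatorname{dom}\lambda)$, with $\nu(\lambda)=\nu_g(\xi)$ for some choice of such $\mu,\xi$; its class does not depend on the choices. A *lift of the identity* of $(Q,\mathcal U)$ is an element $\varepsilon=(\mathrm{id}_Q,\{\tilde f_i\},[P,\nu])$ of $\mathrm{Orb}(\mathcal W,\mathcal V)$, with $\mathcal W,\mathcal V$ representing atlases of $\mathcal U$, all of whose local lifts $\tilde f_i$ are local diffeomorphisms. **The relation.** Let $\mathcal V_1,\mathcal V_2$ be representing atlases of $\mathcal U$ and $\mathcal V'_1,\mathcal V'_2$ of $\mathcal U'$. Charted orbifold maps $\hat f_1\in\mathrm{Orb}(\mathcal V_1,\mathcal V_1')$ and $\hat f_2\in\mathrm{Orb}(\mathcal V_2,\mathcal V_2')$ are *equivalent*, $\hat f_1\sim\hat f_2$, if there are representing atlases $\mathcal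 W$ of $\mathcal U$ and $\mathcal W'$ of $\mathcal U'$, lifts of the identity $\varepsilon_k\in\mathrm{Orb}(\mathcal W,\mathcal V_k)$ of $(Q,\mathcal U)$ and $\varepsilon'_k\in\mathrm{Orb}(\mathcal W',\mathcal V'_k)$ of $(Q',\mathcal U')$ for $k=1,2$, and a charted orbifold map $\hat h\in\mathrm{Orb}(\mathcal W,\mathcal W')$ with $$\hat f_k\circ\varepsilon_k=\varepsilon'_k\circ\hat h\qquad(k=1,2).$$ **Proposition.** For any two orbifolds $(Q,\mathcal U)$ and $(Q',\mathcal U')$, the relation $\sim$ is an equivalence relation on the collection of all charted orbifold maps $\hat f\in\mathrm{Orb}(\mathcal V,\mathcal V')$, where $\mathcal V$ ranges over all representing atlases of $\mathcal U$ and $\mathcal V'$ over all representing atlases of $\mathcal U'$. -/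

import Mathlib

open scoped Manifold ContDiff Topology

universe u

/-! ### Disjoint unions of manifolds -/

section SigmaManifold

variable {n : ℕ} {ι : Type*} {M : ι → Type*} [∀ i, TopologicalSpace (M i)]
  [∀ i, ChartedSpace (EuclideanSpace ℝ (Fin n)) (M i)]

/-- The disjoint union of a family of `n`-manifolds is an `n`-manifold, whose charts are the
charts of the members of the family. -/
noncomputable instance sigmaChartedSpace :
    ChartedSpace (EuclideanSpace ℝ (Fin n)) (Σ i, M i) where
  atlas := {e | ∃ i, ∃ e' ∈ atlas (EuclideanSpace ℝ (Fin n)) (M i),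
    e = e'.lift_openEmbedding (Topology.IsOpenEmbedding.sigmaMk (i := i))}
  chartAt x := (chartAt (EuclideanSpace ℝ (Fin n)) x.2).lift_openEmbedding
    (Topology.IsOpenEmbedding.sigmaMk (i := x.1))
  mem_chart_source x := by
    rw [OpenPartialHomeomorph.lift_openEmbedding_source]
    exact ⟨x.2, mem_chart_source _ x.2, rfl⟩
  chart_mem_atlas x := ⟨x.1, _, chart_mem_atlas _ x.2, rfl⟩

instance sigmaIsManifold [∀ i, IsManifold (𝓡 n) ∞ (M i)] :
    IsManifold (𝓡 n) ∞ (Σ i, M i) where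
  compatible := by
    rintro e₁ e₂ ⟨i, e, he, rfl⟩ ⟨j, e', he', rfl⟩
    by_cases hij : i = j
    · subst hij
      rw [OpenPartialHomeomorph.lift_openEmbedding_trans]
      exact HasGroupoid.compatible he he'
    · refine ContDiffGroupoid.mem_of_source_eq_empty _ ?_
      ext y
      constructor
      · rintro ⟨hy₁, hy₂⟩
        obtain ⟨w, -, hw⟩ := hy₂
        exact (hij (congrArg Sigma.fst hw).symm).elim
      · intro h
        exact h.elim

end SigmaManifold

/-! ### Reduced orbifolds -/

/-- A reduced orbifold chart `(V, G, π)` of dimension `n` on `Q`: a connected smooth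
`n`-manifold `V`, a finite group `G` of diffeomorphisms of `V`, and a map `π : V → Q` with open
image which induces a homeomorphism from `G \ V` onto its image. -/
structure OrbifoldChart (n : ℕ) (Q : Type u) [TopologicalSpace Q] where
  V : Type u
  [top : TopologicalSpace V]
  [t2 : T2Space V]
  [secondCountable : SecondCountableTopology V]
  [connected : ConnectedSpace V]
  [charted : ChartedSpace (EuclideanSpace ℝ (Fin n)) V]
  [isManifold : IsManifold (𝓡 n) ∞ V]
  G : Subgroup (V ≃ₜ V)
  finite_G : Finite G
  contMDiff_G : ∀ g ∈ G, ContMDiff (𝓡 n) (𝓡 n) ∞ g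
  proj : V → Q
  isOpen_range : IsOpen (Set.range proj)
  /-- The fibres of `π` are the `G`-orbits, so the induced map `G \ V → π(V)` is a bijection. -/
  proj_eq_iff : ∀ x y, proj x = proj y ↔ ∃ g ∈ G, g x = y
  /-- The induced bijection `G \ V → π(V)` is a homeomorphism: `π(V)`, with the topology of `Q`,
  carries the quotient topology. -/
  isQuotientMap : Topology.IsQuotientMap (Set.rangeFactorization proj)

attribute [instance] OrbifoldChart.top OrbifoldChart.t2 OrbifoldChart.secondCountable
  OrbifoldChart.connected OrbifoldChart.charted OrbifoldChart.isManifold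

/-- `h` is a diffeomorphism from the open set `h.source` onto the open set `h.target`. -/
def IsSmoothTransition (n : ℕ) {M N : Type*} [TopologicalSpace M] [TopologicalSpace N]
    [ChartedSpace (EuclideanSpace ℝ (Fin n)) M] [ChartedSpace (EuclideanSpace ℝ (Fin n)) N]
    (h : OpenPartialHomeomorph M N) : Prop :=
  ContMDiffOn (𝓡 n) (𝓡 n) ∞ h h.source ∧ ContMDiffOn (𝓡 n) (𝓡 n) ∞ h.symm h.target

namespace OrbifoldChart

variable {n : ℕ} {Q : Type u} [TopologicalSpace Q]

/-- Two charts are compatible if any two points over the same point of `Q` correspond to each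
other under a diffeomorphism over `Q` between neighbourhoods of them. -/
def Compatible (c d : OrbifoldChart n Q) : Prop :=
  ∀ (x : c.V) (y : d.V), c.proj x = d.proj y →
    ∃ h : OpenPartialHomeomorph c.V d.V, IsSmoothTransition n h ∧
      (∀ z ∈ h.source, d.proj (h z) = c.proj z) ∧ x ∈ h.source ∧ h x = y

/-- An open embedding of orbifold charts: a diffeomorphism onto an open subset, over `Q`. -/
def IsEmbedding (c d : OrbifoldChart n Q) (e : c.V → d.V) : Prop :=
  IsLocalDiffeomorph (𝓡 n) (𝓡 n) ∞ e ∧ Function.Injective e ∧ ∀ z, d.proj (e z) = c.proj z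

end OrbifoldChart

/-- A reduced orbifold structure of dimension `n` on `Q`, as a maximal atlas of pairwise compatible
charts. -/
structure OrbifoldStructure (n : ℕ) (Q : Type u) [TopologicalSpace Q] where
  charts : Set (OrbifoldChart n Q)
  covers : ∀ q : Q, ∃ c ∈ charts, q ∈ Set.range c.proj
  compatible : ∀ c ∈ charts, ∀ d ∈ charts, c.Compatible d
  maximal : ∀ c : OrbifoldChart n Q, (∀ d ∈ charts, c.Compatible d) → c ∈ charts

/-- An orbifold atlas representing the orbifold structure `𝒰`: an indexed family of charts of `𝒰`
covering `Q`. The index belongs to the datum of a member of the family, so members with different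
indices are different (disjoint) pieces even when they are copies of the same chart. -/
structure OrbifoldAtlas {n : ℕ} {Q : Type u} [TopologicalSpace Q]
    (𝒰 : OrbifoldStructure n Q) where
  ι : Type u
  chart : ι → OrbifoldChart n Q
  chart_mem : ∀ i, chart i ∈ 𝒰.charts
  covers : ∀ q : Q, ∃ i, q ∈ Set.range (chart i).proj

namespace OrbifoldAtlas

variable {n : ℕ} {Q : Type u} [TopologicalSpace Q] {𝒰 : OrbifoldStructure n Q}

/-- The manifold `∐ i, V i` of an atlas. -/
abbrev Total (𝒱 : OrbifoldAtlas 𝒰) : Type u := Σ i, (𝒱.chart i).V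

/-- The projection `∐ i, π i : ∐ i, V i → Q`. -/
def proj (𝒱 : OrbifoldAtlas 𝒰) (x : 𝒱.Total) : Q := (𝒱.chart x.1).proj x.2

/-- The pseudogroup `Ψ(𝒱)` of all transitions `f` on `∐ i, V i` with `π ∘ f = π` on `dom f`. -/
def Psi (𝒱 : OrbifoldAtlas 𝒰) : Set (OpenPartialHomeomorph 𝒱.Total 𝒱.Total) :=
  {f | IsSmoothTransition n f ∧ ∀ x ∈ f.source, 𝒱.proj (f x) = 𝒱.proj x}

/-- A change of charts of `𝒱`: a diffeomorphism over `Q` from a nonempty open subset of some `V i`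
onto an open subset of some `V j`. -/
def IsChangeOfCharts (𝒱 : OrbifoldAtlas 𝒰) (f : OpenPartialHomeomorph 𝒱.Total 𝒱.Total) : Prop :=
  f ∈ 𝒱.Psi ∧ f.source.Nonempty ∧
    ∃ i j, (∀ x ∈ f.source, x.1 = i) ∧ ∀ y ∈ f.target, y.1 = j

/-- An open embedding between charts of the orbifold structure, seen as an element of `Ψ(𝒱)`: its
domain is an open subset of some `V i` which underlies a chart `c` of `𝒰` (that is, it is the image
of `c` under an open embedding of charts), and it takes values in some `V j`. -/
def IsChartEmbedding (𝒱 : OrbifoldAtlas 𝒰) (f : OpenPartialHomeomorph 𝒱.Total 𝒱.Total) : Prop :=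
  f ∈ 𝒱.Psi ∧
    (∃ i, ∃ c ∈ 𝒰.charts, ∃ e : c.V → (𝒱.chart i).V, c.IsEmbedding (𝒱.chart i) e ∧
      f.source = Set.range fun w => (⟨i, e w⟩ : 𝒱.Total)) ∧
    ∃ j, ∀ y ∈ f.target, y.1 = j

end OrbifoldAtlas

/-! ### Quasi-pseudogroups -/

/-- A quasi-pseudogroup: a set of transitions closed under inversion and composition locally, that
is, on the level of germs. -/
structure IsQuasiPseudogroup {M : Type*} [TopologicalSpace M]
    (P : Set (OpenPartialHomeomorph M M)) : Prop where
  inv : ∀ f ∈ P, ∀ x ∈ f.source, ∃ g ∈ P, f x ∈ g.source ∧ f.symm =ᶠ[𝓝 (f x)] g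
  comp : ∀ f ∈ P, ∀ g ∈ P, ∀ x ∈ f.source, f x ∈ g.source →
    ∃ h ∈ P, x ∈ h.source ∧ g ∘ f =ᶠ[𝓝 x] h

/-- `B` generates the pseudogroup `A` (closed under restriction and gluing): `B` is contained in
`A`, and every germ of an element of `A` is the germ of an element of `B`. -/
def GeneratesPseudogroup {M : Type*} [TopologicalSpace M]
    (B A : Set (OpenPartialHomeomorph M M)) : Prop :=
  B ⊆ A ∧ ∀ f ∈ A, ∀ x ∈ f.source, ∃ g ∈ B, x ∈ g.source ∧ f =ᶠ[𝓝 x] g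

/-! ### Charted orbifold maps -/

section Maps

variable {n n' n'' : ℕ} {Q Q' Q'' : Type u}
  [TopologicalSpace Q] [TopologicalSpace Q'] [TopologicalSpace Q'']
  {𝒰 : OrbifoldStructure n Q} {𝒰' : OrbifoldStructure n' Q'} {𝒰'' : OrbifoldStructure n'' Q''}

/-- A representative `(f, {f̃ i}, P, ν)` of an orbifold map with domain atlas `𝒱` and with range
family contained in `𝒱'`. The family of local lifts is recorded as the map
`lift = ∐ i, f̃ i : ∐ i, V i → ∐ j, V' j`. Equality of germs at `x` is `=ᶠ[𝓝 x]`. -/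
structure OrbifoldMapRep (𝒱 : OrbifoldAtlas 𝒰) (𝒱' : OrbifoldAtlas 𝒰') where
  toFun : Q → Q'
  continuous_toFun : Continuous toFun
  lift : 𝒱.Total → 𝒱'.Total
  /-- Each `f̃ i` maps `V i` to a single chart `V' j`. -/
  lift_chart : ∀ i, ∃ j, ∀ v : (𝒱.chart i).V, (lift ⟨i, v⟩).1 = j
  contMDiff_lift : ContMDiff (𝓡 n) (𝓡 n') ∞ lift
  proj_lift : ∀ x, 𝒱'.proj (lift x) = toFun (𝒱.proj x)
  P : Set (OpenPartialHomeomorph 𝒱.Total 𝒱.Total)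
  isQuasiPseudogroup : IsQuasiPseudogroup P
  isChangeOfCharts : ∀ l ∈ P, 𝒱.IsChangeOfCharts l
  generates : GeneratesPseudogroup P 𝒱.Psi
  ν : P → OpenPartialHomeomorph 𝒱'.Total 𝒱'.Total
  isChartEmbedding_ν : ∀ l : P, 𝒱'.IsChartEmbedding (ν l)
  lift_comp : ∀ l : P, ∀ x ∈ l.1.source,
    lift x ∈ (ν l).source ∧ lift (l.1 x) = ν l (lift x)
  ν_germ : ∀ l m : P, ∀ x, x ∈ l.1.source → x ∈ m.1.source → l.1 =ᶠ[𝓝 x] m.1 →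
    ν l =ᶠ[𝓝 (lift x)] ν m
  ν_mul : ∀ l m h : P, ∀ x, x ∈ l.1.source → l.1 x ∈ m.1.source → x ∈ h.1.source →
    m.1 ∘ l.1 =ᶠ[𝓝 x] h.1 → ν m ∘ ν l =ᶠ[𝓝 (lift x)] ν h
  ν_one : ∀ l : P, ∀ x ∈ l.1.source, l.1 =ᶠ[𝓝 x] id → ν l =ᶠ[𝓝 (lift x)] id

/-- Representatives with the same underlying map, the same local lifts, and whose pairs `(P, ν)`
induce the same map on germs. -/
def OrbifoldMapRep.Equiv {𝒱 : OrbifoldAtlas 𝒰} {𝒱' : OrbifoldAtlas 𝒰'}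
    (f g : OrbifoldMapRep 𝒱 𝒱') : Prop :=
  f.toFun = g.toFun ∧ f.lift = g.lift ∧
    ∀ (l : f.P) (m : g.P) (x : 𝒱.Total), x ∈ l.1.source → x ∈ m.1.source →
      l.1 =ᶠ[𝓝 x] m.1 → f.ν l =ᶠ[𝓝 (f.lift x)] g.ν m

theorem OrbifoldMapRep.equiv_equivalence (𝒱 : OrbifoldAtlas 𝒰) (𝒱' : OrbifoldAtlas 𝒰') :
    Equivalence (OrbifoldMapRep.Equiv (𝒱 := 𝒱) (𝒱' := 𝒱')) where
  refl f := ⟨rfl, rfl, f.ν_germ⟩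
  symm := by
    rintro f g ⟨h₁, h₂, h₃⟩
    refine ⟨h₁.symm, h₂.symm, fun l m x hl hm h => ?_⟩
    rw [← h₂]
    exact (h₃ m l x hm hl h.symm).symm
  trans := by
    rintro f g k ⟨h₁, h₂, h₃⟩ ⟨h₁', h₂', h₃'⟩
    refine ⟨h₁.trans h₁', h₂.trans h₂', fun l m x hl hm h => ?_⟩
    obtain ⟨p, hp, hxp, hlp⟩ := g.generates.2 l.1 (f.generates.1 l.2) x hl
    have a := h₃ l ⟨p, hp⟩ x hl hxp hlp
    have b := h₃' ⟨p, hp⟩ m x hxp hm (hlp.symm.trans h)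
    rw [← h₂] at b
    exact a.trans b

instance OrbifoldMapRep.setoid (𝒱 : OrbifoldAtlas 𝒰) (𝒱' : OrbifoldAtlas 𝒰') :
    Setoid (OrbifoldMapRep 𝒱 𝒱') :=
  ⟨OrbifoldMapRep.Equiv, OrbifoldMapRep.equiv_equivalence 𝒱 𝒱'⟩

/-- `Orbmap(𝒱, 𝒱')`: the charted orbifold maps with domain atlas `𝒱` and range atlas `𝒱'`. -/
def OrbMap (𝒱 : OrbifoldAtlas 𝒰) (𝒱' : OrbifoldAtlas 𝒰') : Type u :=
  Quotient (OrbifoldMapRep.setoid 𝒱 𝒱')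

/-- The underlying map `Q → Q'` of a charted orbifold map. -/
def OrbMap.toFun {𝒱 : OrbifoldAtlas 𝒰} {𝒱' : OrbifoldAtlas 𝒰'} (f : OrbMap 𝒱 𝒱') : Q → Q' :=
  Quotient.lift OrbifoldMapRep.toFun (fun _ _ (h : OrbifoldMapRep.Equiv _ _) => h.1) f

/-- The union of the local lifts of a charted orbifold map. -/
def OrbMap.lift {𝒱 : OrbifoldAtlas 𝒰} {𝒱' : OrbifoldAtlas 𝒰'} (f : OrbMap 𝒱 𝒱') :
    𝒱.Total → 𝒱'.Total :=
  Quotient.lift OrbifoldMapRep.lift (fun _ _ (h : OrbifoldMapRep.Equiv _ _) => h.2.1) f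

/-- A lift of the identity of `(Q, 𝒰)`: a charted orbifold map over `id` all of whose local lifts
are local diffeomorphisms. -/
def OrbMap.IsLiftOfId {𝒱 𝒲 : OrbifoldAtlas 𝒰} (ε : OrbMap 𝒱 𝒲) : Prop :=
  ε.toFun = id ∧ IsLocalDiffeomorph (𝓡 n) (𝓡 n) ∞ ε.lift

/-! ### Composition -/

namespace OrbifoldAtlas

variable {𝒱 : OrbifoldAtlas 𝒰}

theorem symm_mem_Psi {f : OpenPartialHomeomorph 𝒱.Total 𝒱.Total} (hf : f ∈ 𝒱.Psi) :
    f.symm ∈ 𝒱.Psi := by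
  refine ⟨⟨hf.1.2, by simpa using hf.1.1⟩, fun x hx => ?_⟩
  have h := hf.2 (f.symm x) (f.map_target hx)
  rw [f.right_inv hx] at h
  exact h.symm

theorem trans_mem_Psi {f g : OpenPartialHomeomorph 𝒱.Total 𝒱.Total} (hf : f ∈ 𝒱.Psi)
    (hg : g ∈ 𝒱.Psi) : f.trans g ∈ 𝒱.Psi := by
  refine ⟨⟨?_, ?_⟩, fun x hx => ?_⟩
  · rw [f.trans_source g]
    exact hg.1.1.comp (hf.1.1.mono Set.inter_subset_left) fun x hx => hx.2
  · rw [f.trans_target g]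
    exact hf.1.2.comp (hg.1.2.mono Set.inter_subset_left) fun x hx => hx.2
  · rw [f.trans_source g] at hx
    exact (hg.2 _ hx.2).trans (hf.2 _ hx.1)

theorem restrOpen_mem_Psi {f : OpenPartialHomeomorph 𝒱.Total 𝒱.Total} (hf : f ∈ 𝒱.Psi)
    (s : Set 𝒱.Total) (hs : IsOpen s) : f.restrOpen s hs ∈ 𝒱.Psi := by
  refine ⟨⟨hf.1.1.mono ?_, hf.1.2.mono ?_⟩, fun x hx => hf.2 x ?_⟩
  · rw [f.restrOpen_source]; exact Set.inter_subset_left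
  · intro y hy
    have h := (f.restrOpen s hs).map_target hy
    rw [f.restrOpen_source] at h
    have e : f ((f.restrOpen s hs).symm y) = y := (f.restrOpen s hs).right_inv hy
    rw [← e]
    exact f.map_source h.1
  · rw [f.restrOpen_source] at hx; exact hx.1

/-- A generating set of `Ψ(𝒱)` is a quasi-pseudogroup. -/
theorem isQuasiPseudogroup_of_generates {P : Set (OpenPartialHomeomorph 𝒱.Total 𝒱.Total)}
    (hP : GeneratesPseudogroup P 𝒱.Psi) : IsQuasiPseudogroup P where
  inv f hf x hx := hP.2 f.symm (symm_mem_Psi (hP.1 hf)) (f x) (f.map_source hx)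
  comp f hf g hg x hx hx' := hP.2 (f.trans g) (trans_mem_Psi (hP.1 hf) (hP.1 hg)) x
    (by rw [f.trans_source g]; exact ⟨hx, hx'⟩)

end OrbifoldAtlas

section Comp

variable {𝒱 : OrbifoldAtlas 𝒰} {𝒱' : OrbifoldAtlas 𝒰'} {𝒱'' : OrbifoldAtlas 𝒰''}

/-- The quasi-pseudogroup of the composition: the changes of charts `l` which are restrictions of
some `μ ∈ P_f` such that `ν_f(μ)` agrees near the image of `dom l` with some `ξ ∈ P_g`. -/
def OrbifoldMapRep.CompData (g : OrbifoldMapRep 𝒱' 𝒱'') (f : OrbifoldMapRep 𝒱 𝒱')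
    (l : OpenPartialHomeomorph 𝒱.Total 𝒱.Total) (μ : f.P) (ξ : g.P) : Prop :=
  𝒱.IsChangeOfCharts l ∧ ∀ x ∈ l.source, x ∈ μ.1.source ∧ l =ᶠ[𝓝 x] μ.1 ∧
    f.lift x ∈ ξ.1.source ∧ f.ν μ =ᶠ[𝓝 (f.lift x)] ξ.1

def OrbifoldMapRep.compP (g : OrbifoldMapRep 𝒱' 𝒱'') (f : OrbifoldMapRep 𝒱 𝒱') :
    Set (OpenPartialHomeomorph 𝒱.Total 𝒱.Total) :=
  {l | ∃ (μ : f.P) (ξ : g.P), g.CompData f l μ ξ}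

theorem OrbifoldMapRep.compP_generates (g : OrbifoldMapRep 𝒱' 𝒱'') (f : OrbifoldMapRep 𝒱 𝒱') :
    GeneratesPseudogroup (g.compP f) 𝒱.Psi := by
  refine ⟨fun l ⟨_, _, h⟩ => h.1.1, fun h hh x hx => ?_⟩
  obtain ⟨μ, hμ, hxμ, hhμ⟩ := f.generates.2 h hh x hx
  have hx' := (f.lift_comp ⟨μ, hμ⟩ x hxμ).1
  obtain ⟨ξ, hξ, hxξ, hνξ⟩ := g.generates.2 (f.ν ⟨μ, hμ⟩) (f.isChartEmbedding_ν ⟨μ, hμ⟩).1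
    (f.lift x) hx'
  set U : Set 𝒱.Total := interior (f.lift ⁻¹' {y | y ∈ ξ.source ∧ f.ν ⟨μ, hμ⟩ =ᶠ[𝓝 y] ξ}) with hU
  have hxU : x ∈ U := by
    rw [hU, mem_interior_iff_mem_nhds]
    exact f.contMDiff_lift.continuous.continuousAt.preimage_mem_nhds
      (Filter.inter_mem (ξ.open_source.mem_nhds hxξ) hνξ.eventually_nhds)
  have hxl : x ∈ (μ.restrOpen U isOpen_interior).source := by
    rw [μ.restrOpen_source]; exact ⟨hxμ, hxU⟩
  refine ⟨μ.restrOpen U isOpen_interior, ⟨⟨μ, hμ⟩, ⟨ξ, hξ⟩, ⟨?_, ⟨x, hxl⟩, ?_⟩, ?_⟩, hxl, hhμ⟩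
  · exact OrbifoldAtlas.restrOpen_mem_Psi (f.generates.1 hμ) _ _
  · obtain ⟨-, -, i, j, hi, hj⟩ := f.isChangeOfCharts μ hμ
    refine ⟨i, j, fun y hy => hi y ?_, fun y hy => ?_⟩
    · rw [μ.restrOpen_source] at hy; exact hy.1
    · have h := (μ.restrOpen U isOpen_interior).map_target hy
      rw [μ.restrOpen_source] at h
      have e : μ ((μ.restrOpen U isOpen_interior).symm y) = y :=
        (μ.restrOpen U isOpen_interior).right_inv hy
      rw [← e]
      exact hj _ (μ.map_source h.1)
  · intro y hy
    rw [μ.restrOpen_source] at hy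
    obtain ⟨h₁, h₂⟩ := interior_subset hy.2
    exact ⟨hy.1, Filter.EventuallyEq.rfl, h₁, h₂⟩

/-- The composition of representatives: `g ∘ f` with the local lifts `g̃ ∘ f̃`, and with
`ν(l) = ν_g(ξ)` for an element `ξ ∈ P_g` which has the same germs as `ν_f(l)` along the image
of `dom l` under the local lift. -/
noncomputable def OrbifoldMapRep.comp (g : OrbifoldMapRep 𝒱' 𝒱'') (f : OrbifoldMapRep 𝒱 𝒱') :
    OrbifoldMapRep 𝒱 𝒱'' where
  toFun := g.toFun ∘ f.toFun
  continuous_toFun := g.continuous_toFun.comp f.continuous_toFun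
  lift := g.lift ∘ f.lift
  lift_chart i := by
    obtain ⟨j, hj⟩ := f.lift_chart i
    obtain ⟨k, hk⟩ := g.lift_chart j
    refine ⟨k, fun v => ?_⟩
    have h := hj v
    rw [Function.comp_apply]
    generalize f.lift ⟨i, v⟩ = y at h
    obtain ⟨j', w⟩ := y
    cases h
    exact hk w
  contMDiff_lift := g.contMDiff_lift.comp f.contMDiff_lift
  proj_lift x := by
    rw [Function.comp_apply, g.proj_lift, f.proj_lift, Function.comp_apply]
  P := g.compP f
  isQuasiPseudogroup := OrbifoldAtlas.isQuasiPseudogroup_of_generates (g.compP_generates f)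
  isChangeOfCharts := fun l ⟨_, _, h⟩ => h.1
  generates := g.compP_generates f
  ν l := g.ν l.2.choose_spec.choose
  isChartEmbedding_ν l := g.isChartEmbedding_ν _
  lift_comp l x hx := by
    obtain ⟨hxμ, hlμ, hξ, hνξ⟩ := l.2.choose_spec.choose_spec.2 x hx
    have a := (f.lift_comp _ x hxμ).2
    have b := g.lift_comp _ _ hξ
    refine ⟨b.1, ?_⟩
    rw [Function.comp_apply, Function.comp_apply, ← b.2, hlμ.eq_of_nhds, a, hνξ.eq_of_nhds]
  ν_germ l m x hl hm h := by
    obtain ⟨hxμ, hlμ, hξ, hνξ⟩ := l.2.choose_spec.choose_spec.2 x hl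
    obtain ⟨hxμ', hlμ', hξ', hνξ'⟩ := m.2.choose_spec.choose_spec.2 x hm
    exact g.ν_germ _ _ _ hξ hξ' (hνξ.symm.trans
      ((f.ν_germ _ _ x hxμ hxμ' (hlμ.symm.trans (h.trans hlμ'))).trans hνξ'))
  ν_mul l m h x hl hm hh e := by
    obtain ⟨hxμ, hlμ, hξ, hνξ⟩ := l.2.choose_spec.choose_spec.2 x hl
    obtain ⟨hxμ', hlμ', hξ', hνξ'⟩ := m.2.choose_spec.choose_spec.2 _ hm
    obtain ⟨hxμ'', hlμ'', hξ'', hνξ''⟩ := h.2.choose_spec.choose_spec.2 x hh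
    have hlx := hlμ.eq_of_nhds
    have hl_lift := f.lift_comp _ x hxμ
    have hc : Filter.Tendsto l.1 (𝓝 x) (𝓝 (l.1 x)) := l.1.continuousAt hl
    have hcν : Filter.Tendsto (f.ν l.2.choose) (𝓝 (f.lift x)) (𝓝 (f.lift (l.1 x))) := by
      rw [hlx, hl_lift.2]
      exact (f.ν l.2.choose).continuousAt hl_lift.1
    have e' : m.2.choose.1 ∘ l.2.choose.1 =ᶠ[𝓝 x] h.2.choose.1 := by
      refine Filter.EventuallyEq.trans ?_ (e.trans hlμ'')
      filter_upwards [hc.eventually hlμ', hlμ] with y hy₁ hy₂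
      rw [Function.comp_apply, Function.comp_apply, hy₁, hy₂]
    have key := f.ν_mul _ _ _ x hxμ (by rw [← hlx]; exact hxμ') hxμ'' e'
    refine g.ν_mul _ _ _ (f.lift x) hξ ?_ hξ'' ?_
    · rw [← hνξ.eq_of_nhds, ← hl_lift.2, ← hlx]; exact hξ'
    · refine Filter.EventuallyEq.trans ?_ (key.trans hνξ'')
      filter_upwards [hcν.eventually hνξ', hνξ] with y hy₁ hy₂
      rw [Function.comp_apply, Function.comp_apply, hy₁, hy₂]
  ν_one l x hx h := by
    obtain ⟨hxμ, hlμ, hξ, hνξ⟩ := l.2.choose_spec.choose_spec.2 x hx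
    exact g.ν_one _ _ hξ (hνξ.symm.trans (f.ν_one _ x hxμ (hlμ.symm.trans h)))

theorem OrbifoldMapRep.comp_equiv {g g' : OrbifoldMapRep 𝒱' 𝒱''} (hg : g.Equiv g')
    {f f' : OrbifoldMapRep 𝒱 𝒱'} (hf : f.Equiv f') : (g.comp f).Equiv (g'.comp f') := by
  refine ⟨?_, ?_, fun l m x hl hm h => ?_⟩
  · show g.toFun ∘ f.toFun = g'.toFun ∘ f'.toFun
    rw [hg.1, hf.1]
  · show g.lift ∘ f.lift = g'.lift ∘ f'.lift
    rw [hg.2.1, hf.2.1]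
  · obtain ⟨hxμ, hlμ, hξ, hνξ⟩ := l.2.choose_spec.choose_spec.2 x hl
    obtain ⟨hxμ', hlμ', hξ', hνξ'⟩ := m.2.choose_spec.choose_spec.2 x hm
    rw [← hf.2.1] at hξ' hνξ'
    exact hg.2.2 _ _ _ hξ hξ' (hνξ.symm.trans
      ((hf.2.2 _ _ x hxμ hxμ' (hlμ.symm.trans (h.trans hlμ'))).trans hνξ'))

/-- The composition `g ∘ f` of charted orbifold maps. -/
noncomputable def OrbMap.comp (g : OrbMap 𝒱' 𝒱'') (f : OrbMap 𝒱 𝒱') : OrbMap 𝒱 𝒱'' :=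
  Quotient.map₂ OrbifoldMapRep.comp (fun _ _ hg _ _ hf => OrbifoldMapRep.comp_equiv hg hf) g f

end Comp

end Maps

/-! ### The equivalence of charted orbifold maps -/

section Equivalence

variable {n n' : ℕ} {Q Q' : Type u} [TopologicalSpace Q] [TopologicalSpace Q']

/-- A charted orbifold map from `(Q, 𝒰)` to `(Q', 𝒰')`, with arbitrary representing atlases. -/
structure ChartedOrbifoldMap (𝒰 : OrbifoldStructure n Q) (𝒰' : OrbifoldStructure n' Q') where
  domAtlas : OrbifoldAtlas 𝒰
  rangeAtlas : OrbifoldAtlas 𝒰'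
  map : OrbMap domAtlas rangeAtlas

/-- `f₁ ∼ f₂`: both maps induce the same charted orbifold map `h` on atlases `𝒲`, `𝒲'`, via lifts of
the identities. -/
def ChartedOrbifoldMap.Related {𝒰 : OrbifoldStructure n Q} {𝒰' : OrbifoldStructure n' Q'}
    (f₁ f₂ : ChartedOrbifoldMap 𝒰 𝒰') : Prop :=
  ∃ (𝒲 : OrbifoldAtlas 𝒰) (𝒲' : OrbifoldAtlas 𝒰')
    (ε₁ : OrbMap 𝒲 f₁.domAtlas) (ε₂ : OrbMap 𝒲 f₂.domAtlas)
    (ε₁' : OrbMap 𝒲' f₁.rangeAtlas) (ε₂' : OrbMap 𝒲' f₂.rangeAtlas) (h : OrbMap 𝒲 𝒲'),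
    ε₁.IsLiftOfId ∧ ε₂.IsLiftOfId ∧ ε₁'.IsLiftOfId ∧ ε₂'.IsLiftOfId ∧
      f₁.map.comp ε₁ = ε₁'.comp h ∧ f₂.map.comp ε₂ = ε₂'.comp h

end Equivalence

/-! ### Smooth transitions and local diffeomorphisms -/

section Transitions

variable {n : ℕ} {M N K : Type*} [TopologicalSpace M] [TopologicalSpace N] [TopologicalSpace K]
  [ChartedSpace (EuclideanSpace ℝ (Fin n)) M] [ChartedSpace (EuclideanSpace ℝ (Fin n)) N]
  [ChartedSpace (EuclideanSpace ℝ (Fin n)) K]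

/-! Reflexivity holds because identity maps of atlases are lifts of the identity, and symmetry is
built into the definition. Transitivity is the content. If `f₁ ∼ f₂` through `h` and `f₂ ∼ f₃`
through `k`, then `h` and `k` are both induced from the middle map `f = f₂` along lifts of the
identity, and it suffices to find one map `j` on finer atlases that induces both
(`OrbifoldMapRep.exists_common_refinement`); associativity of composition then finishes.

A representative is best seen as a smooth map with a functorial action on germs of transitions,
expressed by `Maps`. Composition of maps is composition of these actions (`maps_comp_iff`), and
functorial, locally constant actions all come from representatives (`exists_of_germ_action`). For a
lift of the identity the action is forced: it is conjugation by a local diffeomorphism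
(`IsLiftOfId.maps`). Hence any local diffeomorphism over `Q` underlies such a lift, and factoring a
map through a lift of the identity is only a matter of lifting its local lifts continuously
(`exists_factorization`).

For the refinement, choose over each `q` a point `w` in the domain of `h` and a point `z` in the
domain of `k`, and a transition `L` from `w` to `z`. Conjugated by the lifts of the identity, `L`
becomes a transition `g` in the domain atlas of `f`. The action of `f` turns `g` into `m`, and `m`
pulls back to a transition `L'` from `h(w)` to `k(z)` (`exists_transition_pair`). An arbitrary `L'`
would not do: `L` and `L'` must correspond under `f`. Small charts around the points `w` and `h(w)`,
with inclusions on one side and `L`, `L'` on the other, form the finer atlases. On them `j` is `h`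
lifted to the piece of the right index. That `j` also induces `k` is checked after composing into
`f` (`equiv_of_comp_equiv`), where the pairs `(g, m)` are a natural transformation between the two
sides (`comp_equiv_of_natural`). -/

theorem IsSmoothTransition.symm {h : OpenPartialHomeomorph M N} (hh : IsSmoothTransition n h) :
    IsSmoothTransition n h.symm :=
  ⟨hh.2, by simpa using hh.1⟩

theorem IsSmoothTransition.trans {h : OpenPartialHomeomorph M N} {k : OpenPartialHomeomorph N K}
    (hh : IsSmoothTransition n h) (hk : IsSmoothTransition n k) :
    IsSmoothTransition n (h.trans k) := by
  refine ⟨?_, ?_⟩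
  · rw [h.trans_source k]
    exact hk.1.comp (hh.1.mono Set.inter_subset_left) fun x hx => hx.2
  · rw [h.trans_target k]
    exact hh.2.comp (hk.2.mono Set.inter_subset_left) fun x hx => hx.2

/-- A map which coincides with smooth transitions near every point is a local diffeomorphism. -/
theorem isLocalDiffeomorph_of_transitions {f : M → N}
    (h : ∀ x, ∃ φ : OpenPartialHomeomorph M N,
      IsSmoothTransition n φ ∧ x ∈ φ.source ∧ Set.EqOn f φ φ.source) :
    IsLocalDiffeomorph (𝓡 n) (𝓡 n) ∞ f := by
  intro x
  obtain ⟨φ, hφ, hx, he⟩ := h x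
  exact ⟨⟨φ.toPartialEquiv, φ.open_source, φ.open_target, hφ.1, hφ.2⟩, hx, he⟩

/-- The underlying function is `f` everywhere, not merely on the source, so `f` can be replaced by
the transition without carrying a restriction along. -/
theorem IsLocalDiffeomorph.exists_transition {f : M → N}
    (hf : IsLocalDiffeomorph (𝓡 n) (𝓡 n) ∞ f) (x : M) :
    ∃ φ : OpenPartialHomeomorph M N, IsSmoothTransition n φ ∧ x ∈ φ.source ∧ ⇑φ = f := by
  obtain ⟨Φ, hx, he⟩ := hf x
  have hinv : ∀ y ∈ Φ.source, f y = Φ y := fun y hy => he hy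
  let ψ : OpenPartialHomeomorph M N :=
    { toFun := f
      invFun := Φ.invFun
      source := Φ.source
      target := Φ.target
      map_source' := fun y hy => by rw [hinv y hy]; exact Φ.map_source' hy
      map_target' := Φ.map_target'
      left_inv' := fun y hy => by rw [hinv y hy]; exact Φ.left_inv' hy
      right_inv' := fun y hy => by
        rw [hinv _ (Φ.map_target' hy)]; exact Φ.right_inv' hy
      open_source := Φ.open_source
      open_target := Φ.open_target
      continuousOn_toFun := (Φ.contMDiffOn_toFun.continuousOn).congr he
      continuousOn_invFun := Φ.contMDiffOn_invFun.continuousOn }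
  exact ⟨ψ, ⟨Φ.contMDiffOn_toFun.congr hinv, Φ.contMDiffOn_invFun⟩, hx, rfl⟩

theorem IsLocalDiffeomorph.comp' {g : N → K} {f : M → N}
    (hg : IsLocalDiffeomorph (𝓡 n) (𝓡 n) ∞ g) (hf : IsLocalDiffeomorph (𝓡 n) (𝓡 n) ∞ f) :
    IsLocalDiffeomorph (𝓡 n) (𝓡 n) ∞ (g ∘ f) := by
  refine isLocalDiffeomorph_of_transitions fun x => ?_
  obtain ⟨φ, hφ, hx, rfl⟩ := hf.exists_transition x
  obtain ⟨χ, hχ, hy, rfl⟩ := hg.exists_transition (φ x)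
  exact ⟨φ.trans χ, hφ.trans hχ, by simp [hx, hy], fun y _ => rfl⟩

theorem IsLocalDiffeomorph.map_nhds_eq {f : M → N}
    (hf : IsLocalDiffeomorph (𝓡 n) (𝓡 n) ∞ f) (x : M) : Filter.map f (𝓝 x) = 𝓝 (f x) := by
  obtain ⟨φ, -, hx, rfl⟩ := hf.exists_transition x
  exact φ.map_nhds_eq hx

/-- Two germs of continuous lifts along a local diffeomorphism agree if they agree at the base
point. -/
theorem IsLocalDiffeomorph.eventuallyEq_of_comp {X : Type*} [TopologicalSpace X] {f : M → N}
    (hf : IsLocalDiffeomorph (𝓡 n) (𝓡 n) ∞ f) {a b : X → M} {x : X} (ha : ContinuousAt a x)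
    (hb : ContinuousAt b x) (hab : a x = b x) (h : f ∘ a =ᶠ[𝓝 x] f ∘ b) : a =ᶠ[𝓝 x] b := by
  obtain ⟨φ, -, hx, rfl⟩ := hf.exists_transition (a x)
  filter_upwards [h, ha.preimage_mem_nhds (φ.open_source.mem_nhds hx),
    hb.preimage_mem_nhds (φ.open_source.mem_nhds (hab ▸ hx))] with y h₁ h₂ h₃
  exact φ.injOn h₂ h₃ h₁

theorem contMDiff_of_comp_isLocalDiffeomorph {m : ℕ} {X : Type*} [TopologicalSpace X]
    [ChartedSpace (EuclideanSpace ℝ (Fin m)) X] {f : M → N}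
    (hf : IsLocalDiffeomorph (𝓡 n) (𝓡 n) ∞ f) {a : X → M} (ha : Continuous a)
    (h : ContMDiff (𝓡 m) (𝓡 n) ∞ (f ∘ a)) : ContMDiff (𝓡 m) (𝓡 n) ∞ a := by
  intro x
  obtain ⟨φ, hφ, hx, rfl⟩ := hf.exists_transition (a x)
  have h₁ : ContMDiffAt (𝓡 m) (𝓡 n) ∞ (φ.symm ∘ (φ ∘ a)) x :=
    ContMDiffAt.comp x (hφ.2.contMDiffAt (φ.open_target.mem_nhds (φ.map_source hx))) (h x)
  refine h₁.congr_of_eventuallyEq ?_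
  filter_upwards [ha.continuousAt.preimage_mem_nhds (φ.open_source.mem_nhds hx)] with y hy
  exact (φ.left_inv hy).symm

theorem isLocalDiffeomorph_subtype_val (U : TopologicalSpace.Opens M) :
    IsLocalDiffeomorph (𝓡 n) (𝓡 n) ∞ (Subtype.val : U → M) := by
  refine isLocalDiffeomorph_of_transitions fun x => ?_
  have : Nonempty U := ⟨x⟩
  refine ⟨U.openPartialHomeomorphSubtypeCoe this, ⟨?_, ?_⟩, by simp, fun y _ => rfl⟩
  · exact contMDiff_subtype_val.contMDiffOn
  · intro y hy
    rw [← ContMDiffWithinAt.subtypeVal_comp_iff]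
    refine contMDiffWithinAt_id.congr_of_mem (fun z hz => ?_) hy
    exact (U.openPartialHomeomorphSubtypeCoe this).right_inv hz

end Transitions

/-! ### Local diffeomorphisms into and out of disjoint unions. -/

section SigmaMk

variable {n : ℕ} {ι : Type*} {M : ι → Type*} [∀ i, TopologicalSpace (M i)]
  [∀ i, ChartedSpace (EuclideanSpace ℝ (Fin n)) (M i)]

/-- The charts of a disjoint union are those of its members transported along the inclusion, so in
charts the inclusion is the identity. -/
theorem isLocalDiffeomorph_sigmaMk [∀ i, IsManifold (𝓡 n) ∞ (M i)] (i : ι) :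
    IsLocalDiffeomorph (𝓡 n) (𝓡 n) ∞ (Sigma.mk i : M i → Σ i, M i) := by
  refine isLocalDiffeomorph_of_transitions fun x => ?_
  set X : Σ i, M i := ⟨i, x⟩
  let φ := chartAt (EuclideanSpace ℝ (Fin n)) x
  let Φ := chartAt (EuclideanSpace ℝ (Fin n)) X
  have hφ : IsSmoothTransition n φ := ⟨contMDiffOn_chart, contMDiffOn_chart_symm⟩
  have hΦ : IsSmoothTransition n Φ := ⟨contMDiffOn_chart, contMDiffOn_chart_symm⟩
  have hs : ((chartAt (EuclideanSpace ℝ (Fin n)) X).symm : _ → Σ i, M i) =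
    Sigma.mk i ∘ (chartAt (EuclideanSpace ℝ (Fin n)) x).symm := rfl
  refine ⟨φ.trans Φ.symm, hφ.trans hΦ.symm, ?_, fun y hy => ?_⟩
  · rw [OpenPartialHomeomorph.trans_source]
    exact ⟨mem_chart_source _ x, φ.map_source (mem_chart_source _ x)⟩
  · rw [OpenPartialHomeomorph.trans_source] at hy
    show _ = Φ.symm (φ y)
    rw [hs, Function.comp_apply, φ.left_inv hy.1]

theorem isLocalDiffeomorph_sigma [∀ i, IsManifold (𝓡 n) ∞ (M i)] {N : Type*} [TopologicalSpace N]
    [ChartedSpace (EuclideanSpace ℝ (Fin n)) N] {f : (Σ i, M i) → N}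
    (hf : ∀ i, IsLocalDiffeomorph (𝓡 n) (𝓡 n) ∞ fun x => f ⟨i, x⟩) :
    IsLocalDiffeomorph (𝓡 n) (𝓡 n) ∞ f := by
  refine isLocalDiffeomorph_of_transitions fun ⟨i, x⟩ => ?_
  obtain ⟨φ, hφ, hx, hfφ⟩ := (hf i).exists_transition x
  obtain ⟨σ, hσ, hx', hs⟩ := (isLocalDiffeomorph_sigmaMk (n := n) (M := M) i).exists_transition x
  refine ⟨σ.symm.trans φ, hσ.symm.trans hφ, ?_, fun y hy => ?_⟩
  · rw [OpenPartialHomeomorph.trans_source]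
    have e : (⟨i, x⟩ : Σ i, M i) = σ x := by rw [hs]
    rw [e]
    exact ⟨σ.map_source hx', by simpa [σ.left_inv hx'] using hx⟩
  · rw [OpenPartialHomeomorph.trans_source] at hy
    have e : σ (σ.symm y) = y := σ.right_inv hy.1
    show f y = φ (σ.symm y)
    rw [hfφ]
    conv_lhs => rw [← e, hs]

end SigmaMk

/-! ### Small orbifold charts -/

namespace OrbifoldChart

variable {n : ℕ} {Q : Type u} [TopologicalSpace Q]

theorem continuous_proj (c : OrbifoldChart n Q) : Continuous c.proj :=
  continuous_subtype_val.comp c.isQuotientMap.continuous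

/-- The saturation of an open set is the union of its translates under the group, hence open. -/
theorem isOpenMap_proj (c : OrbifoldChart n Q) : IsOpenMap c.proj := by
  intro O hO
  have h₁ : IsOpen (Set.rangeFactorization c.proj '' O) := by
    rw [← c.isQuotientMap.isOpen_preimage]
    have : Set.rangeFactorization c.proj ⁻¹' (Set.rangeFactorization c.proj '' O) =
        ⋃ g ∈ c.G, (g : c.V → c.V) '' O := by
      ext y
      simp only [Set.mem_preimage, Set.mem_image, Set.mem_iUnion, exists_prop]
      constructor
      · rintro ⟨x, hx, hxy⟩
        obtain ⟨g, hg, rfl⟩ := (c.proj_eq_iff x y).1 (congrArg Subtype.val hxy)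
        exact ⟨g, hg, x, hx, rfl⟩
      · rintro ⟨g, hg, x, hx, rfl⟩
        exact ⟨x, hx, Subtype.ext ((c.proj_eq_iff _ _).2 ⟨g, hg, rfl⟩)⟩
    rw [this]
    exact isOpen_biUnion fun g _ => g.isOpenMap O hO
  have h₂ := c.isOpen_range.isOpenMap_subtype_val _ h₁
  rwa [← Set.image_comp] at h₂

/-- Every point of an orbifold chart has arbitrarily small connected open neighbourhoods which
are stable under the isotropy group and are displaced by all other group elements. -/
theorem exists_isotropy_nhds (c : OrbifoldChart n Q) (x : c.V) {O : Set c.V} (hO : O ∈ 𝓝 x) :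
    ∃ U : TopologicalSpace.Opens c.V, x ∈ U ∧ (U : Set c.V) ⊆ O ∧ IsConnected (U : Set c.V) ∧
      ∀ g ∈ c.G, (∃ y ∈ U, g y ∈ U) → ∀ y ∈ U, g y ∈ U := by
  have := c.finite_G
  have hN : ∀ g : c.G, ∃ N ∈ 𝓝 x, g.1 x ≠ x → ∀ y ∈ N, g.1 y ∉ N := by
    intro g
    by_cases h : g.1 x = x
    · exact ⟨Set.univ, Filter.univ_mem, fun h' => (h' h).elim⟩
    · obtain ⟨A, B, hA, hB, hxA, hxB, hAB⟩ := t2_separation h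
      refine ⟨B ∩ g.1 ⁻¹' A, Filter.inter_mem (hB.mem_nhds hxB)
        (g.1.continuous.continuousAt.preimage_mem_nhds (hA.mem_nhds hxA)), fun _ y hy hy' => ?_⟩
      exact hAB.le_bot ⟨hy.2, hy'.1⟩
  choose N hNx hN using hN
  set N₁ : Set c.V := interior (O ∩ ⋂ g, N g) with hN₁
  have hxN₁ : x ∈ N₁ := mem_interior_iff_mem_nhds.2
    (Filter.inter_mem hO ((Filter.iInter_mem).2 hNx))
  -- Intersecting over the isotropy group of `x` makes the neighbourhood invariant under it; the
  -- component of `x` inherits the invariance.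
  set N₂ : Set c.V := ⋂ g : {g : c.G // g.1 x = x}, g.1.1 ⁻¹' N₁ with hN₂
  have hN₂o : IsOpen N₂ :=
    isOpen_iInter_of_finite fun g => isOpen_interior.preimage g.1.1.continuous
  have hxN₂ : x ∈ N₂ := Set.mem_iInter.2 fun g => by
    rw [Set.mem_preimage, g.2]; exact hxN₁
  have hsub : N₂ ⊆ N₁ := fun y hy => by
    simpa using Set.mem_iInter.1 hy ⟨1, rfl⟩
  have : LocallyConnectedSpace c.V :=
    ChartedSpace.locallyConnectedSpace (EuclideanSpace ℝ (Fin n)) c.V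
  refine ⟨⟨connectedComponentIn N₂ x, hN₂o.connectedComponentIn⟩,
    mem_connectedComponentIn hxN₂, ?_, isConnected_connectedComponentIn_iff.2 hxN₂, ?_⟩
  · exact ((connectedComponentIn_subset _ _).trans hsub).trans
      (interior_subset.trans Set.inter_subset_left)
  · rintro g hg ⟨y, hy, hgy⟩
    -- An element moving `x` displaces the whole neighbourhood, so one that returns a point to it
    -- must fix `x`.
    have hgx : g x = x := by
      by_contra h
      have hm : ∀ z ∈ connectedComponentIn N₂ x, z ∈ N ⟨g, hg⟩ := fun z hz =>
        Set.mem_iInter.1 (interior_subset (hsub (connectedComponentIn_subset _ _ hz))).2 _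
      exact hN ⟨g, hg⟩ h y (hm y hy) (hm _ hgy)
    have himg : (g : c.V → c.V) '' connectedComponentIn N₂ x ⊆ connectedComponentIn N₂ x := by
      refine IsPreconnected.subset_connectedComponentIn
        (isPreconnected_connectedComponentIn.image _ g.continuous.continuousOn)
        ⟨x, mem_connectedComponentIn hxN₂, hgx⟩ ?_
      rintro _ ⟨z, hz, rfl⟩
      refine Set.mem_iInter.2 fun k => ?_
      have hz' := Set.mem_iInter.1 (connectedComponentIn_subset _ _ hz)
        ⟨k.1 * ⟨g, hg⟩, by
          show k.1.1 (g x) = x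
          rw [hgx, k.2]⟩
      exact hz'
    exact fun z hz => himg ⟨z, hz, rfl⟩

/-- The restriction of an orbifold chart to a connected open subset which every group element
either preserves or displaces. -/
noncomputable def restrict (c : OrbifoldChart n Q) (U : TopologicalSpace.Opens c.V)
    (hU : IsConnected (U : Set c.V))
    (hG : ∀ g ∈ c.G, (∃ y ∈ U, g y ∈ U) → ∀ y ∈ U, g y ∈ U) : OrbifoldChart n Q where
  V := U
  connected := isConnected_iff_connectedSpace.1 hU
  -- Taking the restrictions themselves, as homeomorphisms of `U`, makes the action effective even
  -- if distinct elements of `c.G` agree on `U`.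
  G :=
    { carrier := {g | ∃ k ∈ c.G, ∀ u : U, (g u : c.V) = k u}
      mul_mem' := by
        rintro a b ⟨k, hk, hak⟩ ⟨l, hl, hbl⟩
        refine ⟨k * l, mul_mem hk hl, fun u => ?_⟩
        show ((a (b u) : U) : c.V) = k (l u)
        rw [hak, hbl]
      one_mem' := ⟨1, one_mem _, fun _ => rfl⟩
      inv_mem' := by
        rintro a ⟨k, hk, hak⟩
        refine ⟨k⁻¹, inv_mem hk, fun u => ?_⟩
        show ((a.symm u : U) : c.V) = k.symm u
        rw [Homeomorph.eq_symm_apply, ← hak, a.apply_symm_apply] }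
  finite_G := by
    have := c.finite_G
    have h : ∀ g : {g : U ≃ₜ U // ∃ k ∈ c.G, ∀ u : U, (g u : c.V) = k u},
      ∃ k : c.G, ∀ u : U, (g.1 u : c.V) = k.1 u := fun ⟨g, k, hk, hgk⟩ => ⟨⟨k, hk⟩, hgk⟩
    choose F hF using h
    refine Finite.of_injective F fun a b hab => ?_
    refine Subtype.ext (Homeomorph.ext fun u => Subtype.ext ?_)
    rw [hF a, hF b, hab]
  contMDiff_G := by
    rintro g ⟨k, hk, hgk⟩
    rw [← ContMDiff.subtypeVal_comp_iff]
    have : (Subtype.val ∘ g : U → c.V) = k ∘ Subtype.val := funext hgk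
    rw [this]
    exact (c.contMDiff_G k hk).comp contMDiff_subtype_val
  proj u := c.proj u
  isOpen_range := by
    have : Set.range (fun u : U => c.proj u) = c.proj '' U := by
      ext q
      simp
    rw [this]
    exact c.isOpenMap_proj _ U.isOpen
  proj_eq_iff x y := by
    rw [c.proj_eq_iff]
    constructor
    · rintro ⟨g, hg, hgx⟩
      have h₁ := hG g hg ⟨x, x.2, hgx ▸ y.2⟩
      -- Stability under the inverse as well makes the restriction a bijection of `U`.
      have h₂ := hG g⁻¹ (inv_mem hg) ⟨y, y.2, by
        rw [← hgx]
        show g.symm (g x) ∈ U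
        rw [g.symm_apply_apply]; exact x.2⟩
      refine ⟨{ toFun := fun u => ⟨g u, h₁ u u.2⟩
                invFun := fun u => ⟨g.symm u, h₂ u u.2⟩
                left_inv := fun u => Subtype.ext (g.symm_apply_apply _)
                right_inv := fun u => Subtype.ext (g.apply_symm_apply _)
                continuous_toFun := by fun_prop
                continuous_invFun := by fun_prop }, ⟨g, hg, fun _ => rfl⟩, Subtype.ext hgx⟩
    · rintro ⟨g, ⟨k, hk, hgk⟩, hgx⟩
      exact ⟨k, hk, by rw [← hgk, hgx]⟩
  isQuotientMap := by
    have ho : IsOpenMap fun u : U => c.proj u :=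
      c.isOpenMap_proj.comp U.isOpen.isOpenMap_subtype_val
    have hc : Continuous fun u : U => c.proj u := c.continuous_proj.comp continuous_subtype_val
    refine IsOpenMap.isQuotientMap ?_ (hc.subtype_mk _) Set.rangeFactorization_surjective
    intro O hO
    refine ⟨_, ho O hO, ?_⟩
    ext ⟨q, hq⟩
    simp [Set.rangeFactorization]

theorem isEmbedding_restrict (c : OrbifoldChart n Q) (U : TopologicalSpace.Opens c.V)
    (hU : IsConnected (U : Set c.V))
    (hG : ∀ g ∈ c.G, (∃ y ∈ U, g y ∈ U) → ∀ y ∈ U, g y ∈ U) :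
    (c.restrict U hU hG).IsEmbedding c (Subtype.val : U → c.V) :=
  ⟨isLocalDiffeomorph_subtype_val U, Subtype.val_injective, fun _ => rfl⟩

/-- A chart which embeds into a chart `c` is compatible with every chart which is compatible
with `c`. -/
theorem IsEmbedding.compatible {c d k : OrbifoldChart n Q} {e : d.V → c.V}
    (he : d.IsEmbedding c e) (h : c.Compatible k) : d.Compatible k := by
  intro x y hxy
  obtain ⟨φ, hφ, hx, rfl⟩ := he.1.exists_transition x
  obtain ⟨l, hl, hπ, hlx, hly⟩ := h (φ x) y ((he.2.2 x).trans hxy)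
  refine ⟨φ.trans l, hφ.trans hl, fun z hz => ?_, by simp [hx, hlx], hly⟩
  rw [OpenPartialHomeomorph.trans_source] at hz
  exact (hπ _ hz.2).trans (he.2.2 z)

end OrbifoldChart

/-- Restrictions of `c` are compatible with everything `c` is compatible with, so maximality of the
atlas puts them in `𝒰`. -/
theorem OrbifoldStructure.exists_small_chart {n : ℕ} {Q : Type u} [TopologicalSpace Q]
    (𝒰 : OrbifoldStructure n Q) {c : OrbifoldChart n Q} (hc : c ∈ 𝒰.charts) {x : c.V}
    {O : Set c.V} (hO : O ∈ 𝓝 x) :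
    ∃ d ∈ 𝒰.charts, ∃ e : d.V → c.V, d.IsEmbedding c e ∧ x ∈ Set.range e ∧ Set.range e ⊆ O := by
  obtain ⟨U, hxU, hUO, hU, hG⟩ := c.exists_isotropy_nhds x hO
  have he := c.isEmbedding_restrict U hU hG
  refine ⟨c.restrict U hU hG, 𝒰.maximal _ fun k hk => he.compatible (𝒰.compatible c hc k hk),
    _, he, ?_, ?_⟩
  · exact ⟨⟨x, hxU⟩, rfl⟩
  · rintro _ ⟨u, rfl⟩
    exact hUO u.2

/-! ### Transitions and small charts in the total space of an atlas. -/

namespace OrbifoldAtlas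

variable {n : ℕ} {Q : Type u} [TopologicalSpace Q] {𝒰 : OrbifoldStructure n Q}

theorem continuous_proj (𝒱 : OrbifoldAtlas 𝒰) : Continuous 𝒱.proj :=
  continuous_sigma fun i => (𝒱.chart i).continuous_proj

theorem proj_surjective (𝒱 : OrbifoldAtlas 𝒰) : Function.Surjective 𝒱.proj := by
  intro q
  obtain ⟨i, v, rfl⟩ := 𝒱.covers q
  exact ⟨⟨i, v⟩, rfl⟩

/-- Points of two atlases over the same point correspond to each other under a transition. -/
theorem exists_transition (𝒱 𝒲 : OrbifoldAtlas 𝒰) (x : 𝒱.Total) (y : 𝒲.Total)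
    (h : 𝒱.proj x = 𝒲.proj y) : ∃ l : OpenPartialHomeomorph 𝒱.Total 𝒲.Total,
      IsSmoothTransition n l ∧ (∀ z ∈ l.source, 𝒲.proj (l z) = 𝒱.proj z) ∧ x ∈ l.source ∧
        l x = y := by
  obtain ⟨i, v⟩ := x
  obtain ⟨j, w⟩ := y
  obtain ⟨l, hl, hπ, hv, rfl⟩ := 𝒰.compatible _ (𝒱.chart_mem i) _ (𝒲.chart_mem j) v w h
  obtain ⟨φ, hφ, hvφ, eφ⟩ := (isLocalDiffeomorph_sigmaMk (n := n)
    (M := fun i => (𝒱.chart i).V) i).exists_transition v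
  obtain ⟨χ, hχ, hwχ, eχ⟩ := (isLocalDiffeomorph_sigmaMk (n := n)
    (M := fun i => (𝒲.chart i).V) j).exists_transition (l v)
  have hφv : φ.symm ⟨i, v⟩ = v := by
    have := φ.left_inv hvφ
    rwa [eφ] at this
  refine ⟨φ.symm.trans (l.trans χ), hφ.symm.trans (hl.trans hχ), fun z hz => ?_, ?_, ?_⟩
  · simp only [OpenPartialHomeomorph.trans_source, OpenPartialHomeomorph.symm_source,
      Set.mem_inter_iff, Set.mem_preimage] at hz
    have e : φ (φ.symm z) = z := φ.right_inv hz.1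
    show 𝒲.proj (χ (l (φ.symm z))) = 𝒱.proj z
    rw [← e, eχ, eφ]
    have := hπ _ hz.2.1
    have e' : φ.symm (⟨i, φ.symm z⟩ : 𝒱.Total) = φ.symm z := by
      rw [eφ] at e
      rw [e]
    rw [e']
    exact this
  · simp only [OpenPartialHomeomorph.trans_source, OpenPartialHomeomorph.symm_source,
      Set.mem_inter_iff, Set.mem_preimage]
    refine ⟨?_, by rw [hφv]; exact hv, by rw [hφv]; exact hwχ⟩
    have := φ.map_source hvφ
    rwa [eφ] at this
  · show χ (l (φ.symm ⟨i, v⟩)) = _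
    rw [hφv, eχ]

theorem exists_small_chart (𝒱 : OrbifoldAtlas 𝒰) (x : 𝒱.Total) {O : Set 𝒱.Total}
    (hO : O ∈ 𝓝 x) : ∃ d ∈ 𝒰.charts, ∃ e : d.V → (𝒱.chart x.1).V,
      d.IsEmbedding (𝒱.chart x.1) e ∧ x ∈ Set.range (fun v => (⟨x.1, e v⟩ : 𝒱.Total)) ∧
        ∀ v, (⟨x.1, e v⟩ : 𝒱.Total) ∈ O := by
  obtain ⟨i, v⟩ := x
  have hc : Continuous fun v : (𝒱.chart i).V => (⟨i, v⟩ : 𝒱.Total) :=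
    continuous_sigmaMk (σ := fun i => (𝒱.chart i).V)
  have hO' := hc.continuousAt.preimage_mem_nhds hO
  obtain ⟨d, hd, e, he, ⟨w, rfl⟩, hr⟩ := 𝒰.exists_small_chart (𝒱.chart_mem i) hO'
  exact ⟨d, hd, e, he, ⟨w, rfl⟩, fun w => hr ⟨w, rfl⟩⟩

theorem isLocalDiffeomorph_sigmaMk_comp (𝒱 : OrbifoldAtlas 𝒰) {i : 𝒱.ι} {d : OrbifoldChart n Q}
    {e : d.V → (𝒱.chart i).V} (he : d.IsEmbedding (𝒱.chart i) e) :
    IsLocalDiffeomorph (𝓡 n) (𝓡 n) ∞ fun v => (⟨i, e v⟩ : 𝒱.Total) :=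
  (isLocalDiffeomorph_sigmaMk (n := n) (M := fun i => (𝒱.chart i).V) i).comp' he.1

theorem isOpen_fst_eq (𝒱 : OrbifoldAtlas 𝒰) (i : 𝒱.ι) : IsOpen {x : 𝒱.Total | x.1 = i} := by
  have : {x : 𝒱.Total | x.1 = i} = Set.range (Sigma.mk i : _ → 𝒱.Total) := by
    rw [Set.range_sigmaMk]; rfl
  rw [this]
  exact isOpen_range_sigmaMk

theorem forall_target_restrOpen {M : Type*} [TopologicalSpace M] (f : OpenPartialHomeomorph M M)
    {s : Set M} (hs : IsOpen s) {p : M → Prop} (h : ∀ x ∈ s, p (f x)) :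
    ∀ y ∈ (f.restrOpen s hs).target, p y := by
  intro y hy
  have h' := (f.restrOpen s hs).map_target hy
  rw [f.restrOpen_source] at h'
  have e : f ((f.restrOpen s hs).symm y) = y := (f.restrOpen s hs).right_inv hy
  rw [← e]
  exact h _ h'.2

/-- Values of `ν` must be defined on an orbifold chart and land in one piece; shrinking to a small
chart achieves both without changing the germ. -/
theorem exists_isChartEmbedding {𝒱 : OrbifoldAtlas 𝒰}
    {m : OpenPartialHomeomorph 𝒱.Total 𝒱.Total} (hm : m ∈ 𝒱.Psi) {x : 𝒱.Total}
    (hx : x ∈ m.source) : ∃ (s : Set 𝒱.Total) (hs : IsOpen s), x ∈ s ∧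
      𝒱.IsChartEmbedding (m.restrOpen s hs) := by
  set O : Set 𝒱.Total := m.source ∩ m ⁻¹' {y | y.1 = (m x).1}
  have hO : O ∈ 𝓝 x := Filter.inter_mem (m.open_source.mem_nhds hx)
    ((m.continuousAt hx).preimage_mem_nhds ((𝒱.isOpen_fst_eq _).mem_nhds rfl))
  obtain ⟨d, hd, e, he, hxe, hr⟩ := 𝒱.exists_small_chart x hO
  set s : Set 𝒱.Total := Set.range fun v => (⟨x.1, e v⟩ : 𝒱.Total)
  have hs : IsOpen s := (𝒱.isLocalDiffeomorph_sigmaMk_comp he).isOpen_range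
  have hsO : s ⊆ O := by
    rintro _ ⟨v, rfl⟩
    exact hr v
  refine ⟨s, hs, hxe, restrOpen_mem_Psi hm _ _, ⟨x.1, d, hd, e, he, ?_⟩, (m x).1, ?_⟩
  · rw [m.restrOpen_source]
    exact Set.inter_eq_right.2 (hsO.trans Set.inter_subset_left)
  · exact forall_target_restrOpen m hs (p := fun y => y.1 = (m x).1) fun y hy => (hsO hy).2

theorem exists_isChangeOfCharts {𝒱 : OrbifoldAtlas 𝒰}
    {l : OpenPartialHomeomorph 𝒱.Total 𝒱.Total} (hl : l ∈ 𝒱.Psi) {x : 𝒱.Total}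
    (hx : x ∈ l.source) {O : Set 𝒱.Total} (hO : O ∈ 𝓝 x) :
    ∃ (s : Set 𝒱.Total) (hs : IsOpen s), x ∈ s ∧ s ⊆ O ∧
      𝒱.IsChangeOfCharts (l.restrOpen s hs) := by
  set s : Set 𝒱.Total := interior (O ∩ ({y | y.1 = x.1} ∩ l ⁻¹' {y | y.1 = (l x).1}))
  have hs : IsOpen s := isOpen_interior
  have hxs : x ∈ s := mem_interior_iff_mem_nhds.2 (Filter.inter_mem hO (Filter.inter_mem
    ((𝒱.isOpen_fst_eq _).mem_nhds rfl)
    ((l.continuousAt hx).preimage_mem_nhds ((𝒱.isOpen_fst_eq _).mem_nhds rfl))))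
  have hsub := interior_subset (s := O ∩ ({y | y.1 = x.1} ∩ l ⁻¹' {y | y.1 = (l x).1}))
  refine ⟨s, hs, hxs, fun y hy => (hsub hy).1, restrOpen_mem_Psi hl _ _,
    ⟨x, by rw [l.restrOpen_source]; exact ⟨hx, hxs⟩⟩, x.1, (l x).1, fun y hy => ?_, ?_⟩
  · rw [l.restrOpen_source] at hy
    exact (hsub hy.2).2.1
  · exact forall_target_restrOpen l hs (p := fun y => y.1 = (l x).1) fun y hy => (hsub hy).2.2

end OrbifoldAtlas

/-! ### The action of orbifold maps on germs -/

namespace OrbifoldMapRep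

variable {n n' n'' : ℕ} {Q Q' Q'' : Type u}
  [TopologicalSpace Q] [TopologicalSpace Q'] [TopologicalSpace Q'']
  {𝒰 : OrbifoldStructure n Q} {𝒰' : OrbifoldStructure n' Q'} {𝒰'' : OrbifoldStructure n'' Q''}
  {𝒱 : OrbifoldAtlas 𝒰} {𝒱' : OrbifoldAtlas 𝒰'} {𝒱'' : OrbifoldAtlas 𝒰''}

/-- The representative `f` sends the germ of `l` at `x` to the germ of `m` at `f.lift x`. -/
def Maps (f : OrbifoldMapRep 𝒱 𝒱') (l : 𝒱.Total → 𝒱.Total) (x : 𝒱.Total)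
    (m : 𝒱'.Total → 𝒱'.Total) : Prop :=
  ∃ μ : f.P, x ∈ μ.1.source ∧ l =ᶠ[𝓝 x] μ.1 ∧ f.ν μ =ᶠ[𝓝 (f.lift x)] m

theorem continuous_lift (f : OrbifoldMapRep 𝒱 𝒱') : Continuous f.lift :=
  f.contMDiff_lift.continuous

theorem ν_mem_Psi (f : OrbifoldMapRep 𝒱 𝒱') (μ : f.P) : f.ν μ ∈ 𝒱'.Psi :=
  (f.isChartEmbedding_ν μ).1

theorem Maps.congr {f : OrbifoldMapRep 𝒱 𝒱'} {l l' : 𝒱.Total → 𝒱.Total} {x : 𝒱.Total}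
    {m m' : 𝒱'.Total → 𝒱'.Total} (h : f.Maps l x m) (hl : l =ᶠ[𝓝 x] l')
    (hm : m =ᶠ[𝓝 (f.lift x)] m') : f.Maps l' x m' := by
  obtain ⟨μ, hx, h₁, h₂⟩ := h
  exact ⟨μ, hx, hl.symm.trans h₁, h₂.trans hm⟩

theorem Maps.unique {f : OrbifoldMapRep 𝒱 𝒱'} {l : 𝒱.Total → 𝒱.Total} {x : 𝒱.Total}
    {m m' : 𝒱'.Total → 𝒱'.Total} (h : f.Maps l x m) (h' : f.Maps l x m') :
    m =ᶠ[𝓝 (f.lift x)] m' := by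
  obtain ⟨μ, hx, h₁, h₂⟩ := h
  obtain ⟨μ', hx', h₁', h₂'⟩ := h'
  exact h₂.symm.trans ((f.ν_germ _ _ x hx hx' (h₁.symm.trans h₁')).trans h₂')

theorem exists_maps (f : OrbifoldMapRep 𝒱 𝒱') {l : OpenPartialHomeomorph 𝒱.Total 𝒱.Total}
    (hl : l ∈ 𝒱.Psi) {x : 𝒱.Total} (hx : x ∈ l.source) :
    ∃ m ∈ 𝒱'.Psi, f.lift x ∈ m.source ∧ f.Maps l x m := by
  obtain ⟨μ, hμ, hxμ, h⟩ := f.generates.2 l hl x hx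
  exact ⟨f.ν ⟨μ, hμ⟩, f.ν_mem_Psi _, (f.lift_comp ⟨μ, hμ⟩ x hxμ).1, ⟨μ, hμ⟩, hxμ, h, .rfl⟩

/-- The same `m` serves all nearby points: the action is locally constant along transitions. -/
theorem Maps.eventually {f : OrbifoldMapRep 𝒱 𝒱'} {l : 𝒱.Total → 𝒱.Total} {x : 𝒱.Total}
    {m : 𝒱'.Total → 𝒱'.Total} (h : f.Maps l x m) : ∀ᶠ y in 𝓝 x, f.Maps l y m := by
  obtain ⟨μ, hx, h₁, h₂⟩ := h
  filter_upwards [μ.1.open_source.mem_nhds hx, h₁.eventually_nhds,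
    f.continuous_lift.continuousAt.eventually h₂.eventually_nhds] with y h₃ h₄ h₅
  exact ⟨μ, h₃, h₄, h₅⟩

theorem Maps.lift_apply {f : OrbifoldMapRep 𝒱 𝒱'} {l : 𝒱.Total → 𝒱.Total} {x : 𝒱.Total}
    {m : 𝒱'.Total → 𝒱'.Total} (h : f.Maps l x m) : f.lift (l x) = m (f.lift x) := by
  obtain ⟨μ, hx, h₁, h₂⟩ := h
  rw [h₁.eq_of_nhds, ← h₂.eq_of_nhds, (f.lift_comp μ x hx).2]

theorem Maps.continuousAt {f : OrbifoldMapRep 𝒱 𝒱'} {l : 𝒱.Total → 𝒱.Total} {x : 𝒱.Total}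
    {m : 𝒱'.Total → 𝒱'.Total} (h : f.Maps l x m) : ContinuousAt l x := by
  obtain ⟨μ, hx, h₁, h₂⟩ := h
  exact (μ.1.continuousAt hx).congr h₁.symm

theorem Maps.continuousAt_right {f : OrbifoldMapRep 𝒱 𝒱'} {l : 𝒱.Total → 𝒱.Total} {x : 𝒱.Total}
    {m : 𝒱'.Total → 𝒱'.Total} (h : f.Maps l x m) : ContinuousAt m (f.lift x) := by
  obtain ⟨μ, hx, h₁, h₂⟩ := h
  exact ((f.ν μ).continuousAt (f.lift_comp μ x hx).1).congr h₂

theorem Maps.comp {f : OrbifoldMapRep 𝒱 𝒱'} {l l' : 𝒱.Total → 𝒱.Total} {x y : 𝒱.Total}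
    {m m' : 𝒱'.Total → 𝒱'.Total} (h' : f.Maps l' y m') (h : f.Maps l x m) (hy : l x = y) :
    f.Maps (l' ∘ l) x (m' ∘ m) := by
  subst hy
  have hm := h.lift_apply
  have hc := h.continuousAt
  have hcm := h.continuousAt_right
  obtain ⟨μ, hx, h₁, h₂⟩ := h
  obtain ⟨μ', hx', h₁', h₂'⟩ := h'
  rw [h₁.eq_of_nhds] at hx'
  obtain ⟨κ, hκ, hxκ, h₃⟩ := f.isQuasiPseudogroup.comp μ.1 μ.2 μ'.1 μ'.2 x hx hx'
  refine ⟨⟨κ, hκ⟩, hxκ, ?_, ?_⟩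
  · refine Filter.EventuallyEq.trans ?_ h₃
    filter_upwards [h₁, hc.eventually h₁'] with y hy hy'
    rw [Function.comp_apply, Function.comp_apply, hy', hy]
  · refine (f.ν_mul μ μ' ⟨κ, hκ⟩ x hx hx' hxκ h₃).symm.trans ?_
    rw [hm] at h₂'
    filter_upwards [h₂, hcm.eventually h₂'] with y hy hy'
    rw [Function.comp_apply, Function.comp_apply, hy, hy']

theorem maps_id (f : OrbifoldMapRep 𝒱 𝒱') (x : 𝒱.Total) : f.Maps id x id := by
  have h : OpenPartialHomeomorph.refl 𝒱.Total ∈ 𝒱.Psi :=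
    ⟨⟨contMDiff_id.contMDiffOn, contMDiff_id.contMDiffOn⟩, fun _ _ => rfl⟩
  obtain ⟨μ, hμ, hx, h₁⟩ := f.generates.2 _ h x trivial
  exact ⟨⟨μ, hμ⟩, hx, h₁, f.ν_one ⟨μ, hμ⟩ x hx h₁.symm⟩

/-- Inverses are not among the axioms on `ν`. The image of the inverse germ is a left inverse of
`m`, by functoriality and uniqueness, and so equals the germ of `m.symm`. -/
theorem Maps.symm {f : OrbifoldMapRep 𝒱 𝒱'} {l : OpenPartialHomeomorph 𝒱.Total 𝒱.Total}
    {x : 𝒱.Total} {m : OpenPartialHomeomorph 𝒱'.Total 𝒱'.Total} (h : f.Maps l x m)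
    (hl : l ∈ 𝒱.Psi) (hx : x ∈ l.source) (hm : f.lift x ∈ m.source) :
    f.Maps l.symm (l x) m.symm := by
  obtain ⟨k, hk, hxk, hlk⟩ := f.exists_maps (OrbifoldAtlas.symm_mem_Psi hl) (l.map_source hx)
  refine hlk.congr .rfl ?_
  have h₁ := hlk.comp h rfl
  have h₀ : l.symm ∘ l =ᶠ[𝓝 x] id := l.eventually_left_inverse hx
  have h₂ : f.Maps (l.symm ∘ l) x id := (f.maps_id x).congr h₀.symm .rfl
  have h₃ := h₁.unique h₂
  rw [h.lift_apply]
  have hc : Filter.Tendsto m.symm (𝓝 (m (f.lift x))) (𝓝 (f.lift x)) := by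
    have := m.symm.continuousAt (m.map_source hm)
    rwa [ContinuousAt, m.left_inv hm] at this
  filter_upwards [hc.eventually h₃, m.eventually_right_inverse (m.map_source hm)] with y h₄ h₅
  rw [Function.comp_apply, h₅] at h₄
  exact h₄

/-- This hides the choices made in `comp`: from here on, composition is only composition of germ
actions. -/
theorem maps_comp_iff {g : OrbifoldMapRep 𝒱' 𝒱''} {f : OrbifoldMapRep 𝒱 𝒱'}
    {l : 𝒱.Total → 𝒱.Total} {x : 𝒱.Total} {k : 𝒱''.Total → 𝒱''.Total} :
    (g.comp f).Maps l x k ↔ ∃ m, f.Maps l x m ∧ g.Maps m (f.lift x) k := by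
  constructor
  · rintro ⟨μ, hx, h₁, h₂⟩
    obtain ⟨hxμ, hlμ, hξ, hνξ⟩ := μ.2.choose_spec.choose_spec.2 x hx
    exact ⟨_, ⟨_, hxμ, h₁.trans hlμ, .rfl⟩, ⟨_, hξ, hνξ, h₂⟩⟩
  · rintro ⟨m, ⟨μ, hx, h₁, h₂⟩, ⟨ξ, hξ, h₃, h₄⟩⟩
    obtain ⟨κ, hκ, hxκ, h₅⟩ := (g.compP_generates f).2 μ.1 (f.generates.1 μ.2) x hx
    obtain ⟨hxμ, hlμ, hξ', hνξ'⟩ := hκ.choose_spec.choose_spec.2 x hxκ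
    refine ⟨⟨κ, hκ⟩, hxκ, h₁.trans h₅, ?_⟩
    refine Filter.EventuallyEq.trans ?_ h₄
    exact g.ν_germ _ _ _ hξ' hξ (hνξ'.symm.trans
      ((f.ν_germ _ _ x hxμ hx (hlμ.symm.trans h₅.symm)).trans (h₂.trans h₃)))

/-- Two representatives are equivalent as soon as they have the same lifts and send every germ to
a common germ. -/
theorem equiv_of_maps {f g : OrbifoldMapRep 𝒱 𝒱'} (hlift : f.lift = g.lift)
    (h : ∀ l ∈ 𝒱.Psi, ∀ x ∈ l.source, ∃ m, f.Maps l x m ∧ g.Maps l x m) : f.Equiv g := by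
  refine ⟨funext fun q => ?_, hlift, fun l m x hl hm e => ?_⟩
  · obtain ⟨x, rfl⟩ := 𝒱.proj_surjective q
    rw [← f.proj_lift, ← g.proj_lift, hlift]
  · obtain ⟨k, h₁, h₂⟩ := h l.1 (f.generates.1 l.2) x hl
    have a : f.Maps l.1 x (f.ν l) := ⟨l, hl, .rfl, .rfl⟩
    have b : g.Maps l.1 x (g.ν m) := ⟨m, hm, e, .rfl⟩
    have b' := h₂.unique b
    rw [← hlift] at b'
    exact (a.unique h₁).trans b'

theorem Equiv.maps {f g : OrbifoldMapRep 𝒱 𝒱'} (h : f.Equiv g) {l : 𝒱.Total → 𝒱.Total}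
    {x : 𝒱.Total} {m : 𝒱'.Total → 𝒱'.Total} (hf : f.Maps l x m) : g.Maps l x m := by
  obtain ⟨μ, hx, h₁, h₂⟩ := hf
  obtain ⟨κ, hκ, hxκ, h₃⟩ := g.generates.2 μ.1 (f.generates.1 μ.2) x hx
  refine ⟨⟨κ, hκ⟩, hxκ, h₁.trans h₃, ?_⟩
  rw [← h.2.1]
  exact (h.2.2 μ ⟨κ, hκ⟩ x hx hxκ h₃).symm.trans h₂

theorem comp_assoc_equiv {n₃ : ℕ} {Q₃ : Type u} [TopologicalSpace Q₃]
    {𝒰₃ : OrbifoldStructure n₃ Q₃} {𝒱₃ : OrbifoldAtlas 𝒰₃} (k : OrbifoldMapRep 𝒱'' 𝒱₃)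
    (g : OrbifoldMapRep 𝒱' 𝒱'') (f : OrbifoldMapRep 𝒱 𝒱') :
    ((k.comp g).comp f).Equiv (k.comp (g.comp f)) := by
  refine equiv_of_maps rfl fun l hl x hx => ?_
  obtain ⟨a, ha, hxa, h₁⟩ := f.exists_maps hl hx
  obtain ⟨b, hb, hxb, h₂⟩ := g.exists_maps ha hxa
  obtain ⟨c, hc, hxc, h₃⟩ := k.exists_maps hb hxb
  exact ⟨c, maps_comp_iff.2 ⟨a, h₁, maps_comp_iff.2 ⟨b, h₂, h₃⟩⟩,
    maps_comp_iff.2 ⟨b, maps_comp_iff.2 ⟨a, h₁, h₂⟩, h₃⟩⟩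

/-- An action on germs which is functorial and locally constant along transitions comes from a
representative of an orbifold map. -/
theorem exists_of_germ_action (f : Q → Q') (hf : Continuous f) (ψ : 𝒱.Total → 𝒱'.Total)
    (hψ : ContMDiff (𝓡 n) (𝓡 n') ∞ ψ) (hπ : ∀ x, 𝒱'.proj (ψ x) = f (𝒱.proj x))
    (T : (𝒱.Total → 𝒱.Total) → 𝒱.Total → (𝒱'.Total → 𝒱'.Total) → Prop)
    (hex : ∀ l ∈ 𝒱.Psi, ∀ x ∈ l.source, ∃ m ∈ 𝒱'.Psi, ψ x ∈ m.source ∧ ∀ᶠ y in 𝓝 x, T l y m)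
    (hcongr : ∀ l l' x m, T l x m → l =ᶠ[𝓝 x] l' → T l' x m)
    (hT : ∀ l x m, T l x m → ψ (l x) = m (ψ x))
    (huniq : ∀ l x m m', T l x m → T l x m' → m =ᶠ[𝓝 (ψ x)] m')
    (hcomp : ∀ l l' x m m', T l x m → T l' (l x) m' → T (l' ∘ l) x (m' ∘ m))
    (hid : ∀ x, T id x id) :
    ∃ F : OrbifoldMapRep 𝒱 𝒱', F.toFun = f ∧ F.lift = ψ ∧ ∀ l ∈ 𝒱.Psi, ∀ x ∈ l.source,
      ∃ m ∈ 𝒱'.Psi, ψ x ∈ m.source ∧ T l x m ∧ F.Maps l x m := by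
  -- The changes of charts on whose whole domain one chart embedding realises `T`. Local constancy
  -- of `T` and shrinking show that there are enough of them.
  let P : Set (OpenPartialHomeomorph 𝒱.Total 𝒱.Total) :=
    {l | 𝒱.IsChangeOfCharts l ∧ ∃ m, 𝒱'.IsChartEmbedding m ∧
      ∀ x ∈ l.source, ψ x ∈ m.source ∧ T l x m}
  have hgen : GeneratesPseudogroup P 𝒱.Psi := by
    refine ⟨fun l hl => hl.1.1, fun l hl x hx => ?_⟩
    obtain ⟨m, hm, hxm, hTm⟩ := hex l hl x hx
    obtain ⟨s, hs, hxs, hsm⟩ := OrbifoldAtlas.exists_isChartEmbedding hm hxm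
    obtain ⟨t, ht, hxt, htO, htl⟩ := OrbifoldAtlas.exists_isChangeOfCharts hl hx
      (Filter.inter_mem hTm (hψ.continuous.continuousAt.preimage_mem_nhds
        ((m.restrOpen s hs).open_source.mem_nhds (by rw [m.restrOpen_source]; exact ⟨hxm, hxs⟩))))
    refine ⟨l.restrOpen t ht, ⟨htl, m.restrOpen s hs, hsm, fun y hy => ?_⟩, ?_, .rfl⟩
    · rw [l.restrOpen_source] at hy
      exact ⟨(htO hy.2).2, (htO hy.2).1⟩
    · rw [l.restrOpen_source]
      exact ⟨hx, hxt⟩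
  have hν : ∀ l : P, ∃ m, 𝒱'.IsChartEmbedding m ∧ ∀ x ∈ l.1.source, ψ x ∈ m.source ∧ T l.1 x m :=
    fun l => l.2.2
  choose ν hν₁ hν₂ using hν
  refine ⟨{
    toFun := f
    continuous_toFun := hf
    lift := ψ
    lift_chart := fun i => ?_
    contMDiff_lift := hψ
    proj_lift := hπ
    P := P
    isQuasiPseudogroup := OrbifoldAtlas.isQuasiPseudogroup_of_generates hgen
    isChangeOfCharts := fun l hl => hl.1
    generates := hgen
    ν := ν
    isChartEmbedding_ν := hν₁
    lift_comp := fun l x hx => ⟨(hν₂ l x hx).1, hT _ _ _ (hν₂ l x hx).2⟩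
    ν_germ := fun l m x hl hm h =>
      huniq _ x _ _ (hν₂ l x hl).2 (hcongr _ _ _ _ (hν₂ m x hm).2 h.symm)
    ν_mul := fun l m h x hl hm hh e =>
      huniq _ x _ _ (hcongr _ _ _ _ (hcomp _ _ x _ _ (hν₂ l x hl).2 (hν₂ m _ hm).2) e)
        (hν₂ h x hh).2
    ν_one := fun l x hx h =>
      huniq _ x _ _ (hν₂ l x hx).2 (hcongr _ _ _ _ (hid x) h.symm) }, rfl, rfl, ?_⟩
  -- A chart is connected and each piece of the target is clopen, so `ψ` cannot leave the piece that
  -- contains the image of one point.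
  · have hc : Continuous fun v : (𝒱.chart i).V => (⟨i, v⟩ : 𝒱.Total) :=
      continuous_sigmaMk (σ := fun i => (𝒱.chart i).V)
    obtain ⟨v₀⟩ := (inferInstance : Nonempty (𝒱.chart i).V)
    refine ⟨(ψ ⟨i, v₀⟩).1, fun v => ?_⟩
    have hcl : IsClopen {y : 𝒱'.Total | y.1 = (ψ ⟨i, v₀⟩).1} := by
      refine ⟨⟨?_⟩, 𝒱'.isOpen_fst_eq _⟩
      have : {y : 𝒱'.Total | y.1 = (ψ ⟨i, v₀⟩).1}ᶜ =
          ⋃ j : {j // j ≠ (ψ ⟨i, v₀⟩).1}, {y : 𝒱'.Total | y.1 = j} := by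
        ext y
        simp
      rw [this]
      exact isOpen_iUnion fun j => 𝒱'.isOpen_fst_eq _
    have h := (hcl.preimage (hψ.continuous.comp hc)).eq_univ ⟨v₀, rfl⟩
    exact Set.eq_univ_iff_forall.1 h v
  · intro l hl x hx
    obtain ⟨κ, hκ, hxκ, h₁⟩ := hgen.2 l hl x hx
    obtain ⟨h₂, h₃⟩ := hν₂ ⟨κ, hκ⟩ x hxκ
    exact ⟨ν ⟨κ, hκ⟩, (hν₁ _).1, h₂, hcongr _ _ _ _ h₃ h₁.symm, ⟨κ, hκ⟩, hxκ, h₁, .rfl⟩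

end OrbifoldMapRep

/-! ### Lifts of the identity -/

namespace OrbifoldMapRep

variable {n n' : ℕ} {Q Q' : Type u} [TopologicalSpace Q] [TopologicalSpace Q']
  {𝒰 : OrbifoldStructure n Q} {𝒰' : OrbifoldStructure n' Q'}

/-- A representative of a lift of the identity. -/
def IsLiftOfId {𝒱 𝒲 : OrbifoldAtlas 𝒰} (ε : OrbifoldMapRep 𝒱 𝒲) : Prop :=
  ε.toFun = id ∧ IsLocalDiffeomorph (𝓡 n) (𝓡 n) ∞ ε.lift

theorem IsLiftOfId.comp {𝒱 𝒲 𝒳 : OrbifoldAtlas 𝒰} {δ : OrbifoldMapRep 𝒲 𝒳}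
    {ε : OrbifoldMapRep 𝒱 𝒲} (hδ : δ.IsLiftOfId) (hε : ε.IsLiftOfId) : (δ.comp ε).IsLiftOfId := by
  refine ⟨?_, hδ.2.comp' hε.2⟩
  show δ.toFun ∘ ε.toFun = id
  rw [hδ.1, hε.1, Function.id_comp]

theorem IsLiftOfId.proj_lift {𝒱 𝒲 : OrbifoldAtlas 𝒰} {ε : OrbifoldMapRep 𝒱 𝒲}
    (hε : ε.IsLiftOfId) (x : 𝒱.Total) : 𝒲.proj (ε.lift x) = 𝒱.proj x := by
  rw [ε.proj_lift, hε.1]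
  rfl

/-- This fixes `m` only along the image of `f.lift`. It determines the germ of `m` when `f.lift` is
a local diffeomorphism. -/
theorem Maps.lift_comp_eventuallyEq {𝒱 : OrbifoldAtlas 𝒰} {𝒱' : OrbifoldAtlas 𝒰'}
    {f : OrbifoldMapRep 𝒱 𝒱'} {l : 𝒱.Total → 𝒱.Total} {x : 𝒱.Total}
    {m : 𝒱'.Total → 𝒱'.Total} (h : f.Maps l x m) : m ∘ f.lift =ᶠ[𝓝 x] f.lift ∘ l := by
  filter_upwards [h.eventually] with y hy
  exact hy.lift_apply.symm

theorem _root_.IsLocalDiffeomorph.eventuallyEq_of_comp_right {M N X : Type*} [TopologicalSpace M]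
    [TopologicalSpace N] [ChartedSpace (EuclideanSpace ℝ (Fin n)) M]
    [ChartedSpace (EuclideanSpace ℝ (Fin n)) N] {f : M → N}
    (hf : IsLocalDiffeomorph (𝓡 n) (𝓡 n) ∞ f) {x : M} {a b : N → X}
    (h : a ∘ f =ᶠ[𝓝 x] b ∘ f) : a =ᶠ[𝓝 (f x)] b := by
  rw [← hf.map_nhds_eq x]
  exact h

/-- The action of a lift of the identity on germs is conjugation by the local lifts. -/
theorem IsLiftOfId.maps {𝒱 𝒲 : OrbifoldAtlas 𝒰} {ε : OrbifoldMapRep 𝒱 𝒲} (hε : ε.IsLiftOfId)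
    {l : OpenPartialHomeomorph 𝒱.Total 𝒱.Total} (hl : l ∈ 𝒱.Psi) {x : 𝒱.Total}
    (hx : x ∈ l.source) {m : 𝒲.Total → 𝒲.Total} (h : m ∘ ε.lift =ᶠ[𝓝 x] ε.lift ∘ l) :
    ε.Maps l x m := by
  obtain ⟨m₀, hm₀, hxm₀, h₀⟩ := ε.exists_maps hl hx
  exact h₀.congr .rfl
    (hε.2.eventuallyEq_of_comp_right (h₀.lift_comp_eventuallyEq.trans h.symm))

/-- Every local diffeomorphism over `Q` between the total spaces of atlases underlies a lift of
the identity. -/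
theorem exists_isLiftOfId {𝒱 𝒲 : OrbifoldAtlas 𝒰} {ψ : 𝒱.Total → 𝒲.Total}
    (hψ : IsLocalDiffeomorph (𝓡 n) (𝓡 n) ∞ ψ) (hπ : ∀ x, 𝒲.proj (ψ x) = 𝒱.proj x) :
    ∃ ε : OrbifoldMapRep 𝒱 𝒲, ε.IsLiftOfId ∧ ε.lift = ψ := by
  refine (exists_of_germ_action (𝒱 := 𝒱) (𝒱' := 𝒲) id continuous_id ψ hψ.contMDiff hπ
    -- The action is conjugation by `ψ`. Continuity of `l` is kept because composing two such
    -- relations evaluates the second one at `l y` for `y` near `x`.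
    (fun l x m => ContinuousAt l x ∧ m ∘ ψ =ᶠ[𝓝 x] ψ ∘ l) ?_ ?_ ?_ ?_ ?_ ?_).elim
    fun ε hε => ⟨ε, ⟨hε.1, hε.2.1 ▸ hψ⟩, hε.2.1⟩
  · intro l hl x hx
    obtain ⟨φ, hφ, hxφ, eφ⟩ := hψ.exists_transition x
    obtain ⟨χ, hχ, hxχ, eχ⟩ := hψ.exists_transition (l x)
    have hsrc : ψ x ∈ (φ.symm.trans (l.trans χ)).source := by
      simp only [OpenPartialHomeomorph.trans_source, OpenPartialHomeomorph.symm_source,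
        Set.mem_inter_iff, Set.mem_preimage, ← eφ, φ.left_inv hxφ]
      exact ⟨φ.map_source hxφ, hx, hxχ⟩
    refine ⟨φ.symm.trans (l.trans χ), ⟨hφ.symm.trans (hl.1.trans hχ), fun y hy => ?_⟩, hsrc, ?_⟩
    · simp only [OpenPartialHomeomorph.trans_source, OpenPartialHomeomorph.symm_source,
        Set.mem_inter_iff, Set.mem_preimage] at hy
      show 𝒲.proj (χ (l (φ.symm y))) = 𝒲.proj y
      rw [eχ, hπ, hl.2 _ hy.2.1, ← hπ, ← eφ, φ.right_inv hy.1]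
    · have h : ∀ᶠ y in 𝓝 x, (φ.symm.trans (l.trans χ)) (ψ y) = ψ (l y) := by
        filter_upwards [φ.open_source.mem_nhds hxφ] with y hy
        show χ (l (φ.symm (ψ y))) = ψ (l y)
        rw [← eφ, φ.left_inv hy, eχ, eφ]
      filter_upwards [h.eventually_nhds, l.open_source.mem_nhds hx] with y hy hy'
      exact ⟨l.continuousAt hy', hy⟩
  · intro l l' x m h e
    exact ⟨h.1.congr e, h.2.trans (e.fun_comp ψ)⟩
  · intro l x m h
    exact h.2.eq_of_nhds.symm
  · intro l x m m' h h'
    exact hψ.eventuallyEq_of_comp_right (h.2.trans h'.2.symm)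
  · intro l l' x m m' h h'
    refine ⟨h'.1.comp h.1, ?_⟩
    filter_upwards [h.2, h.1.eventually h'.2] with y h₁ h₂
    simp only [Function.comp_apply] at h₁ h₂ ⊢
    rw [h₁, h₂]
  · exact fun x => ⟨continuousAt_id, .rfl⟩

/-- A map into the range of a lift of the identity factors through it if its local lifts do. -/
theorem exists_factorization {𝒳 : OrbifoldAtlas 𝒰} {𝒳' 𝒲' : OrbifoldAtlas 𝒰'}
    (F : OrbifoldMapRep 𝒳 𝒲') {ε : OrbifoldMapRep 𝒳' 𝒲'} (hε : ε.IsLiftOfId)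
    {ψ : 𝒳.Total → 𝒳'.Total} (hψ : Continuous ψ) (hψF : ε.lift ∘ ψ = F.lift) :
    ∃ G : OrbifoldMapRep 𝒳 𝒳', G.lift = ψ ∧ (ε.comp G).Equiv F := by
  have hψF' : ∀ x, ε.lift (ψ x) = F.lift x := congrFun hψF
  have hπ : ∀ x, 𝒳'.proj (ψ x) = F.toFun (𝒳.proj x) := fun x => by
    rw [← hε.proj_lift, hψF', F.proj_lift]
  refine (exists_of_germ_action (𝒱 := 𝒳) (𝒱' := 𝒳') F.toFun F.continuous_toFun ψ
    (contMDiff_of_comp_isLocalDiffeomorph hε.2 hψ (hψF ▸ F.contMDiff_lift)) hπ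
    -- `m` lifts the image `k` of `l` under `F` through `ε`. As `ε.lift` need not be injective,
    -- continuity and the prescribed value at `ψ x` are what single out its germ.
    (fun l x m => ContinuousAt m (ψ x) ∧ m (ψ x) = ψ (l x) ∧
      ∃ k, F.Maps l x k ∧ k ∘ ε.lift =ᶠ[𝓝 (ψ x)] ε.lift ∘ m) ?_ ?_ ?_ ?_ ?_ ?_).elim fun G hG => ?_
  · intro l hl x hx
    obtain ⟨k, hk, hxk, hlk⟩ := F.exists_maps hl hx
    obtain ⟨φ, hφ, hxφ, eφ⟩ := hε.2.exists_transition (ψ x)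
    obtain ⟨χ, hχ, hxχ, eχ⟩ := hε.2.exists_transition (ψ (l x))
    have hk' : ∀ y, F.Maps l y k → k (ε.lift (ψ y)) = ε.lift (ψ (l y)) := fun y hy => by
      rw [hψF', hψF', hy.lift_apply]
    have hval : ∀ y, F.Maps l y k → ψ (l y) ∈ χ.source → χ.symm (k (φ (ψ y))) = ψ (l y) := by
      intro y hy hy'
      rw [eφ, hk' y hy, ← eχ, χ.left_inv hy']
    have hsrc : ∀ y, F.Maps l y k → ψ y ∈ φ.source → ψ (l y) ∈ χ.source → F.lift y ∈ k.source →
        ψ y ∈ (φ.trans (k.trans χ.symm)).source := by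
      intro y hy h₁ h₂ h₃
      simp only [OpenPartialHomeomorph.trans_source, OpenPartialHomeomorph.symm_source,
        Set.mem_inter_iff, Set.mem_preimage]
      rw [eφ, hk' y hy, hψF', ← eχ]
      exact ⟨h₁, h₃, χ.map_source h₂⟩
    have hlψ : ContinuousAt (fun y => ψ (l y)) x := hψ.continuousAt.comp (l.continuousAt hx)
    -- `φ` and `χ` are branches of `ε.lift` at `ψ x` and `ψ (l x)`; the choice of the second gives
    -- the lift of `k` the value `ψ (l x)`.
    refine ⟨φ.trans (k.trans χ.symm), ⟨hφ.trans (hk.1.trans hχ.symm), fun y hy => ?_⟩,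
      hsrc x hlk hxφ hxχ hxk, ?_⟩
    · simp only [OpenPartialHomeomorph.trans_source, OpenPartialHomeomorph.symm_source,
        Set.mem_inter_iff, Set.mem_preimage] at hy
      show 𝒳'.proj (χ.symm (k (φ y))) = 𝒳'.proj y
      rw [← hε.proj_lift, ← eχ, χ.right_inv hy.2.2, hk.2 _ hy.2.1, eφ, hε.proj_lift]
    · filter_upwards [hlk.eventually, hψ.continuousAt.preimage_mem_nhds (φ.open_source.mem_nhds hxφ),
        hlψ.preimage_mem_nhds (χ.open_source.mem_nhds hxχ),
        F.continuous_lift.continuousAt.preimage_mem_nhds (k.open_source.mem_nhds hxk)]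
        with y h₁ h₂ h₃ h₄
      have hs := hsrc y h₁ h₂ h₃ h₄
      refine ⟨(φ.trans (k.trans χ.symm)).continuousAt hs, hval y h₁ h₃, k, h₁, ?_⟩
      filter_upwards [(φ.trans (k.trans χ.symm)).open_source.mem_nhds hs] with z hz
      simp only [OpenPartialHomeomorph.trans_source, OpenPartialHomeomorph.symm_source,
        Set.mem_inter_iff, Set.mem_preimage] at hz
      show k (ε.lift z) = ε.lift (χ.symm (k (φ z)))
      rw [← eχ, χ.right_inv hz.2.2, eφ, eχ]
  · rintro l l' x m ⟨h₁, h₂, k, h₃, h₄⟩ e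
    exact ⟨h₁, by rw [h₂, e.eq_of_nhds], k, h₃.congr e .rfl, h₄⟩
  · exact fun l x m h => h.2.1.symm
  · rintro l x m m' ⟨h₁, h₂, k, h₃, h₄⟩ ⟨h₁', h₂', k', h₃', h₄'⟩
    refine hε.2.eventuallyEq_of_comp h₁ h₁' (h₂.trans h₂'.symm) (h₄.symm.trans (.trans ?_ h₄'))
    have e := h₃.unique h₃'
    rw [← hψF'] at e
    exact ε.continuous_lift.continuousAt.eventually e
  · rintro l l' x m m' ⟨h₁, h₂, k, h₃, h₄⟩ ⟨h₁', h₂', k', h₃', h₄'⟩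
    rw [← h₂] at h₁' h₄'
    refine ⟨h₁'.comp h₁, ?_, k' ∘ k, h₃'.comp h₃ rfl, ?_⟩
    · rw [Function.comp_apply, h₂, h₂', Function.comp_apply]
    · filter_upwards [h₄, h₁.eventually h₄'] with y hy hy'
      simp only [Function.comp_apply] at hy hy' ⊢
      rw [hy, hy']
  · exact fun x => ⟨continuousAt_id, rfl, id, F.maps_id x, .rfl⟩
  · obtain ⟨-, h₂, h₃⟩ := hG
    refine ⟨G, h₂, equiv_of_maps (by rw [← hψF, ← h₂]; rfl) fun l hl x hx => ?_⟩
    obtain ⟨m, hm, hxm, ⟨-, -, k, hFk, hk⟩, hGm⟩ := h₃ l hl x hx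
    subst h₂
    exact ⟨k, maps_comp_iff.2 ⟨m, hGm, hε.maps hm hxm hk⟩, hFk⟩

/-- Maps into the domain of a lift of the identity are determined by their local lifts and by
their composition with it. -/
theorem equiv_of_comp_equiv {𝒳 : OrbifoldAtlas 𝒰} {𝒳' 𝒲' : OrbifoldAtlas 𝒰'}
    {F G : OrbifoldMapRep 𝒳 𝒳'} {ε : OrbifoldMapRep 𝒳' 𝒲'} (hε : ε.IsLiftOfId)
    (hFG : F.lift = G.lift) (h : (ε.comp F).Equiv (ε.comp G)) : F.Equiv G := by
  refine equiv_of_maps hFG fun l hl x hx => ?_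
  obtain ⟨a, ha, hxa, h₁⟩ := F.exists_maps hl hx
  obtain ⟨b, hb, hxb, h₂⟩ := G.exists_maps hl hx
  obtain ⟨c, hc, hxc, h₃⟩ := ε.exists_maps ha hxa
  obtain ⟨b', h₂', h₃'⟩ := maps_comp_iff.1 (h.maps (maps_comp_iff.2 ⟨a, h₁, h₃⟩))
  have hx' : F.lift x = G.lift x := congrFun hFG x
  have e₁ := h₃.lift_comp_eventuallyEq
  have e₂ := h₃'.lift_comp_eventuallyEq
  have h₁' := h₂'.continuousAt_right
  have h₂'' := h₂'.lift_apply
  rw [← hFG] at e₂ h₁' h₂''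
  -- The germs of `a` and `b'` both lift the germ `c` through `ε.lift` and agree at the base point,
  -- so they coincide.
  have e := hε.2.eventuallyEq_of_comp h₁.continuousAt_right h₁'
    (h₁.lift_apply.symm.trans h₂'') (e₁.symm.trans e₂)
  exact ⟨a, h₁, h₂'.congr .rfl (hx' ▸ e.symm)⟩

/-- If two pairs of lifts of the identity are related by a natural transformation which is
compatible with `f`, then they induce the same maps from `f`. -/
theorem comp_equiv_of_natural {𝒳 𝒱 : OrbifoldAtlas 𝒰} {𝒳' 𝒱' : OrbifoldAtlas 𝒰'}
    {f : OrbifoldMapRep 𝒱 𝒱'} {h : OrbifoldMapRep 𝒳 𝒳'} {A B : OrbifoldMapRep 𝒳 𝒱}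
    {A' B' : OrbifoldMapRep 𝒳' 𝒱'} (hB : B.IsLiftOfId) (hB' : B'.IsLiftOfId)
    (hfA : (f.comp A).Equiv (A'.comp h))
    (H : ∀ x, ∃ g ∈ 𝒱.Psi, ∃ m ∈ 𝒱'.Psi, A.lift x ∈ g.source ∧ f.lift (A.lift x) ∈ m.source ∧
      f.Maps g (A.lift x) m ∧ g ∘ A.lift =ᶠ[𝓝 x] B.lift ∧
      m ∘ A'.lift =ᶠ[𝓝 (h.lift x)] B'.lift) :
    (f.comp B).Equiv (B'.comp h) := by
  have hlA : ∀ x, f.lift (A.lift x) = A'.lift (h.lift x) := congrFun hfA.2.1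
  refine equiv_of_maps (funext fun x => ?_) fun l hl x hx => ?_
  · obtain ⟨g, hg, m, hm, hxg, hxm, hgm, e, e'⟩ := H x
    show f.lift (B.lift x) = B'.lift (h.lift x)
    rw [← e.eq_of_nhds, ← e'.eq_of_nhds, Function.comp_apply, Function.comp_apply,
      hgm.lift_apply, hlA]
  obtain ⟨a, ha, hxa, hla⟩ := A.exists_maps hl hx
  obtain ⟨c, hc, hxc, hac⟩ := f.exists_maps ha hxa
  obtain ⟨b, hlb, hbc⟩ := maps_comp_iff.1 (hfA.maps (maps_comp_iff.2 ⟨a, hla, hac⟩))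
  obtain ⟨b₀, hb₀, hxb₀, hlb₀⟩ := h.exists_maps hl hx
  -- `b` is only a function; an honest transition with the same germ is needed to apply `hB'.maps`
  -- later.
  replace hbc : A'.Maps b₀ (h.lift x) c := hbc.congr (hlb.unique hlb₀) .rfl
  obtain ⟨g, hg, m, hm, hxg, hxm, hgm, e, e'⟩ := H x
  obtain ⟨g₁, hg₁, m₁, hm₁, hxg₁, hxm₁, hgm₁, e₁, e₁'⟩ := H (l x)
  have hBx : B.lift x = g (A.lift x) := e.eq_of_nhds.symm
  -- By naturality `B` sends `l` to `g₁ ∘ a ∘ g⁻¹`. Functoriality of `f` gives `m₁ ∘ c ∘ m⁻¹`, which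
  -- is also what `B'` makes of `b₀`.
  have hf : f.Maps (g₁ ∘ a ∘ g.symm) (B.lift x) (m₁ ∘ c ∘ m.symm) := by
    rw [hBx]
    refine hgm₁.comp (hac.comp (hgm.symm hg hxg hxm) (g.left_inv hxg)) ?_
    rw [Function.comp_apply, g.left_inv hxg, hla.lift_apply]
  refine ⟨m₁ ∘ c ∘ m.symm, maps_comp_iff.2 ⟨g₁ ∘ a ∘ g.symm, hB.maps hl hx ?_, hf⟩,
    maps_comp_iff.2 ⟨b₀, hlb₀, hB'.maps hb₀ hxb₀ ?_⟩⟩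
  · filter_upwards [e, (l.continuousAt hx).eventually e₁, hla.lift_comp_eventuallyEq,
      A.continuous_lift.continuousAt.preimage_mem_nhds (g.open_source.mem_nhds hxg)]
      with y h₁ h₂ h₃ h₄
    simp only [Function.comp_apply] at h₁ h₂ h₃ ⊢
    rw [← h₁, g.left_inv h₄, h₃, h₂]
  · have hcb := hlb₀.continuousAt_right
    rw [ContinuousAt, ← hlb₀.lift_apply] at hcb
    rw [hlA] at hxm
    filter_upwards [e', hcb.eventually e₁', hbc.lift_comp_eventuallyEq,
      A'.continuous_lift.continuousAt.preimage_mem_nhds (m.open_source.mem_nhds hxm)]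
      with y h₁ h₂ h₃ h₄
    simp only [Function.comp_apply] at h₁ h₂ h₃ ⊢
    rw [← h₁, m.left_inv h₄, h₃, h₂]

end OrbifoldMapRep

/-! ### Common refinements -/

theorem IsLocalDiffeomorph.transition_comp {n : ℕ} {M N K : Type*} [TopologicalSpace M]
    [TopologicalSpace N] [TopologicalSpace K] [ChartedSpace (EuclideanSpace ℝ (Fin n)) M]
    [ChartedSpace (EuclideanSpace ℝ (Fin n)) N] [ChartedSpace (EuclideanSpace ℝ (Fin n)) K]
    {e : M → N} (he : IsLocalDiffeomorph (𝓡 n) (𝓡 n) ∞ e) {L : OpenPartialHomeomorph N K}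
    (hL : IsSmoothTransition n L) (h : ∀ x, e x ∈ L.source) :
    IsLocalDiffeomorph (𝓡 n) (𝓡 n) ∞ fun x => L (e x) := by
  refine isLocalDiffeomorph_of_transitions fun x => ?_
  obtain ⟨φ, hφ, hx, rfl⟩ := he.exists_transition x
  exact ⟨φ.trans L, hφ.trans hL, by simp [hx, h x], fun y _ => rfl⟩

namespace OrbifoldMapRep

variable {n n' : ℕ} {Q Q' : Type u} [TopologicalSpace Q] [TopologicalSpace Q']
  {𝒰 : OrbifoldStructure n Q} {𝒰' : OrbifoldStructure n' Q'}

theorem Equiv.symm {𝒱 : OrbifoldAtlas 𝒰} {𝒱' : OrbifoldAtlas 𝒰'} {f g : OrbifoldMapRep 𝒱 𝒱'}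
    (h : f.Equiv g) : g.Equiv f :=
  (equiv_equivalence 𝒱 𝒱').symm h

theorem Equiv.trans {𝒱 : OrbifoldAtlas 𝒰} {𝒱' : OrbifoldAtlas 𝒰'} {f g k : OrbifoldMapRep 𝒱 𝒱'}
    (h : f.Equiv g) (h' : g.Equiv k) : f.Equiv k :=
  (equiv_equivalence 𝒱 𝒱').trans h h'

theorem Equiv.refl {𝒱 : OrbifoldAtlas 𝒰} {𝒱' : OrbifoldAtlas 𝒰'} (f : OrbifoldMapRep 𝒱 𝒱') :
    f.Equiv f :=
  (equiv_equivalence 𝒱 𝒱').refl f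

/-- A family of transitions between two atlases, defined near points which cover `Q`, gives rise
to a common refinement consisting of small charts. -/
theorem exists_refinement {𝒲 𝒵 : OrbifoldAtlas 𝒰} {ι : Type u} (p : ι → 𝒲.Total)
    (L : ι → OpenPartialHomeomorph 𝒲.Total 𝒵.Total) (hL : ∀ i, IsSmoothTransition n (L i))
    (hLπ : ∀ i, ∀ x ∈ (L i).source, 𝒵.proj (L i x) = 𝒲.proj x) (O : ι → Set 𝒲.Total)
    (hO : ∀ i, O i ∈ 𝓝 (p i)) (hOL : ∀ i, O i ⊆ (L i).source)
    (hcov : ∀ q, ∃ i, 𝒲.proj (p i) = q) :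
    ∃ (𝒳 : OrbifoldAtlas 𝒰) (idx : 𝒳.Total → ι) (α : OrbifoldMapRep 𝒳 𝒲)
      (β : OrbifoldMapRep 𝒳 𝒵), α.IsLiftOfId ∧ β.IsLiftOfId ∧ (∀ x, α.lift x ∈ O (idx x)) ∧
      (∀ x, β.lift x = L (idx x) (α.lift x)) ∧ (∀ x, ∀ᶠ y in 𝓝 x, idx y = idx x) ∧
      ∀ i, ∃ x, α.lift x = p i ∧ idx x = i := by
  have h := fun i => 𝒲.exists_small_chart (p i) (hO i)
  choose d hd e he hp hr using h
  choose v hv using hp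
  let E : ∀ i, (d i).V → 𝒲.Total := fun i v => ⟨(p i).1, e i v⟩
  have hEπ : ∀ i v, 𝒲.proj (E i v) = (d i).proj v := fun i v => (he i).2.2 v
  -- One piece for each index, so that different transitions remain available on overlapping images;
  -- the index of a point is then locally constant.
  let 𝒳 : OrbifoldAtlas 𝒰 :=
    { ι := ι
      chart := d
      chart_mem := hd
      covers := fun q => by
        obtain ⟨i, rfl⟩ := hcov q
        refine ⟨i, v i, ?_⟩
        rw [← hEπ]
        exact congrArg 𝒲.proj (hv i) }
  have hE : ∀ i, IsLocalDiffeomorph (𝓡 n) (𝓡 n) ∞ (E i) :=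
    fun i => 𝒲.isLocalDiffeomorph_sigmaMk_comp (he i)
  obtain ⟨α, hα, eα⟩ := exists_isLiftOfId (𝒱 := 𝒳) (𝒲 := 𝒲) (ψ := fun x => E x.1 x.2)
    (isLocalDiffeomorph_sigma (M := fun i => (d i).V) hE) (fun x => hEπ x.1 x.2)
  obtain ⟨β, hβ, eβ⟩ := exists_isLiftOfId (𝒱 := 𝒳) (𝒲 := 𝒵) (ψ := fun x => L x.1 (E x.1 x.2))
    (isLocalDiffeomorph_sigma (M := fun i => (d i).V)
      fun i => (hE i).transition_comp (hL i) fun v => hOL i (hr i v))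
    (fun x => (hLπ x.1 _ (hOL _ (hr _ _))).trans (hEπ x.1 x.2))
  refine ⟨𝒳, Sigma.fst, α, β, hα, hβ, fun x => ?_, fun x => ?_, fun x =>
    (𝒳.isOpen_fst_eq x.1).mem_nhds rfl, fun i => ⟨⟨i, v i⟩, ?_, rfl⟩⟩
  · rw [eα]
    exact hr _ _
  · rw [eα, eβ]
  · rw [eα]
    exact hv i

/-- Along lifts of the identity, a transition between the domains of two maps which are induced
from `f` is accompanied by a transition between their ranges. -/
theorem exists_transition_pair {𝒱 𝒲 𝒵 : OrbifoldAtlas 𝒰} {𝒱' 𝒲' 𝒵' : OrbifoldAtlas 𝒰'}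
    {f : OrbifoldMapRep 𝒱 𝒱'} {h : OrbifoldMapRep 𝒲 𝒲'} {k : OrbifoldMapRep 𝒵 𝒵'}
    {ε : OrbifoldMapRep 𝒲 𝒱} {ε' : OrbifoldMapRep 𝒲' 𝒱'} {δ : OrbifoldMapRep 𝒵 𝒱}
    {δ' : OrbifoldMapRep 𝒵' 𝒱'} (hε : ε.IsLiftOfId) (hε' : ε'.IsLiftOfId) (hδ : δ.IsLiftOfId)
    (hδ' : δ'.IsLiftOfId) (hh : (f.comp ε).Equiv (ε'.comp h)) (hk : (f.comp δ).Equiv (δ'.comp k))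
    (w : 𝒲.Total) (z : 𝒵.Total) (hwz : 𝒲.proj w = 𝒵.proj z) :
    ∃ L : OpenPartialHomeomorph 𝒲.Total 𝒵.Total, ∃ L' : OpenPartialHomeomorph 𝒲'.Total 𝒵'.Total,
      ∃ g ∈ 𝒱.Psi, ∃ m ∈ 𝒱'.Psi,
      IsSmoothTransition n L ∧ (∀ x ∈ L.source, 𝒵.proj (L x) = 𝒲.proj x) ∧ w ∈ L.source ∧
      IsSmoothTransition n' L' ∧ (∀ x ∈ L'.source, 𝒵'.proj (L' x) = 𝒲'.proj x) ∧
      h.lift w ∈ L'.source ∧ (∀ y ∈ L'.source, m (ε'.lift y) = δ'.lift (L' y)) ∧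
      ∀ᶠ x in 𝓝 w, ε.lift x ∈ g.source ∧ f.lift (ε.lift x) ∈ m.source ∧
        f.Maps g (ε.lift x) m ∧ g (ε.lift x) = δ.lift (L x) ∧ L' (h.lift x) = k.lift (L x) := by
  have hh' : ∀ x, f.lift (ε.lift x) = ε'.lift (h.lift x) := congrFun hh.2.1
  have hk' : ∀ x, f.lift (δ.lift x) = δ'.lift (k.lift x) := congrFun hk.2.1
  obtain ⟨L, hL, hLπ, hwL, rfl⟩ := 𝒲.exists_transition 𝒵 w z hwz
  obtain ⟨φ, hφ, hwφ, eφ⟩ := hε.2.exists_transition w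
  obtain ⟨χ, hχ, hwχ, eχ⟩ := hδ.2.exists_transition (L w)
  -- `L` seen in the domain atlas of `f`, by means of local branches of `ε` and `δ`.
  let g := φ.symm.trans (L.trans χ)
  have hgε : ∀ x ∈ φ.source, g (ε.lift x) = δ.lift (L x) := fun x hx => by
    show χ (L (φ.symm (ε.lift x))) = _
    rw [← eφ, φ.left_inv hx, eχ]
  have hg : g ∈ 𝒱.Psi := by
    refine ⟨hφ.symm.trans (hL.trans hχ), fun y hy => ?_⟩
    simp only [g, OpenPartialHomeomorph.trans_source, OpenPartialHomeomorph.symm_source,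
      Set.mem_inter_iff, Set.mem_preimage] at hy
    show 𝒱.proj (χ (L (φ.symm y))) = 𝒱.proj y
    rw [eχ, hδ.proj_lift, hLπ _ hy.2.1, ← hε.proj_lift, ← eφ, φ.right_inv hy.1]
  have hwg : ε.lift w ∈ g.source := by
    simp only [g, OpenPartialHomeomorph.trans_source, OpenPartialHomeomorph.symm_source,
      Set.mem_inter_iff, Set.mem_preimage]
    rw [← eφ, φ.left_inv hwφ]
    exact ⟨φ.map_source hwφ, hwL, hwχ⟩
  obtain ⟨m, hm, hwm, hgm⟩ := f.exists_maps hg hwg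
  obtain ⟨φ', hφ', hwφ', eφ'⟩ := hε'.2.exists_transition (h.lift w)
  -- The branch of `δ'` is taken at `k.lift (L w)`, which forces the resulting `L'` to carry
  -- `h.lift` to `k.lift ∘ L` near `w`.
  obtain ⟨χ', hχ', hwχ', eχ'⟩ := hδ'.2.exists_transition (k.lift (L w))
  have hval : ∀ x ∈ φ.source, f.Maps g (ε.lift x) m →
      m (ε'.lift (h.lift x)) = δ'.lift (k.lift (L x)) := fun x hx hx' => by
    rw [← hh', ← hx'.lift_apply, hgε x hx, hk']
  have hsrc : ∀ y, y ∈ (φ'.trans (m.trans χ'.symm)).source ↔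
      y ∈ φ'.source ∧ ε'.lift y ∈ m.source ∧ m (ε'.lift y) ∈ χ'.target := fun y => by
    simp only [OpenPartialHomeomorph.trans_source, OpenPartialHomeomorph.symm_source,
      Set.mem_inter_iff, Set.mem_preimage, eφ']
  have hL'δ : ∀ y ∈ (φ'.trans (m.trans χ'.symm)).source,
      m (ε'.lift y) = δ'.lift ((φ'.trans (m.trans χ'.symm)) y) := fun y hy => by
    show _ = δ'.lift (χ'.symm (m (φ' y)))
    rw [← eχ', eφ', χ'.right_inv ((hsrc y).1 hy).2.2]
  refine ⟨L, φ'.trans (m.trans χ'.symm), g, hg, m, hm, hL, hLπ, hwL,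
    hφ'.trans (hm.1.trans hχ'.symm), fun y hy => ?_, ?_, hL'δ, ?_⟩
  · rw [← hδ'.proj_lift, ← hL'δ y hy, hm.2 _ ((hsrc y).1 hy).2.1, hε'.proj_lift]
  · rw [hsrc, ← hh' w, ← hgm.lift_apply, hgε w hwφ, hk', ← eχ']
    exact ⟨hwφ', hwm, χ'.map_source hwχ'⟩
  · have hc₁ := ε.continuous_lift.continuousAt (x := w)
    have hc₂ : ContinuousAt (fun x => k.lift (L x)) w :=
      k.continuous_lift.continuousAt.comp (L.continuousAt hwL)
    filter_upwards [hc₁.preimage_mem_nhds (g.open_source.mem_nhds hwg),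
      (f.continuous_lift.continuousAt.comp hc₁).preimage_mem_nhds (m.open_source.mem_nhds hwm),
      hc₁.eventually hgm.eventually, φ.open_source.mem_nhds hwφ,
      hc₂.preimage_mem_nhds (χ'.open_source.mem_nhds hwχ')] with x h₁ h₂ h₃ h₄ h₅
    refine ⟨h₁, h₂, h₃, hgε x h₄, ?_⟩
    show χ'.symm (m (φ' (h.lift x))) = _
    rw [eφ', hval x h₄ h₃, ← eχ', χ'.left_inv h₅]

/-- Two maps which are induced from `f` along lifts of the identity induce a common map. -/
theorem exists_common_refinement {𝒱 𝒲 𝒵 : OrbifoldAtlas 𝒰} {𝒱' 𝒲' 𝒵' : OrbifoldAtlas 𝒰'}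
    {f : OrbifoldMapRep 𝒱 𝒱'} {h : OrbifoldMapRep 𝒲 𝒲'} {k : OrbifoldMapRep 𝒵 𝒵'}
    {ε : OrbifoldMapRep 𝒲 𝒱} {ε' : OrbifoldMapRep 𝒲' 𝒱'} {δ : OrbifoldMapRep 𝒵 𝒱}
    {δ' : OrbifoldMapRep 𝒵' 𝒱'} (hε : ε.IsLiftOfId) (hε' : ε'.IsLiftOfId) (hδ : δ.IsLiftOfId)
    (hδ' : δ'.IsLiftOfId) (hh : (f.comp ε).Equiv (ε'.comp h))
    (hk : (f.comp δ).Equiv (δ'.comp k)) :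
    ∃ (𝒳 : OrbifoldAtlas 𝒰) (𝒳' : OrbifoldAtlas 𝒰') (α : OrbifoldMapRep 𝒳 𝒲)
      (β : OrbifoldMapRep 𝒳 𝒵) (α' : OrbifoldMapRep 𝒳' 𝒲') (β' : OrbifoldMapRep 𝒳' 𝒵')
      (j : OrbifoldMapRep 𝒳 𝒳'), α.IsLiftOfId ∧ β.IsLiftOfId ∧ α'.IsLiftOfId ∧ β'.IsLiftOfId ∧
      (h.comp α).Equiv (α'.comp j) ∧ (k.comp β).Equiv (β'.comp j) := by
  choose w hw using 𝒲.proj_surjective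
  choose z hz using 𝒵.proj_surjective
  choose w' hw' using 𝒲'.proj_surjective
  choose z' hz' using 𝒵'.proj_surjective
  choose L L' g hg m hm hL hLπ hwL hL' hLπ' hwL' hmδ hev using fun q =>
    exists_transition_pair hε hε' hδ hδ' hh hk (w q) (z q) ((hw q).trans (hz q).symm)
  choose K hK hKπ hwK hKz using fun q => 𝒲'.exists_transition 𝒵' (w' q) (z' q)
    ((hw' q).trans (hz' q).symm)
  -- Pieces indexed by `Q` carry the transitions `L'` paired with `L`. They lie over the image of
  -- `f` and may miss points, so pieces indexed by `Q'`, with arbitrary transitions, are added to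
  -- cover `Q'`.
  obtain ⟨𝒳', idx', α', β', hα', hβ', hmem', hβα', hloc', hpt'⟩ :=
    exists_refinement (𝒲 := 𝒲') (𝒵 := 𝒵') (ι := Q ⊕ Q') (Sum.elim (fun q => h.lift (w q)) w')
      (Sum.elim L' K) (by rintro (q | q); exacts [hL' q, hK q])
      (by rintro (q | q); exacts [hLπ' q, hKπ q]) (fun i => (Sum.elim L' K i).source)
      (by rintro (q | q)
          exacts [(L' q).open_source.mem_nhds (hwL' q), (K q).open_source.mem_nhds (hwK q)])
      (fun _ => subset_rfl) (fun q => ⟨Sum.inr q, hw' q⟩)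
  -- Local sections of `α'` near `h.lift (w q)` with values in the piece `Sum.inl q`. Since the
  -- piece decides which transition defines `β'`, prescribing it is essential.
  have hsec : ∀ q, ∃ (N : Set 𝒲'.Total) (s : 𝒲'.Total → 𝒳'.Total), IsOpen N ∧ h.lift (w q) ∈ N ∧
      ContinuousOn s N ∧ ∀ y ∈ N, α'.lift (s y) = y ∧ idx' (s y) = Sum.inl q := by
    intro q
    obtain ⟨x, hx, hxq⟩ := hpt' (Sum.inl q)
    obtain ⟨φ, -, hxφ, eφ⟩ := hα'.2.exists_transition x
    have hc : φ.target ∩ φ.symm ⁻¹' {y | idx' y = Sum.inl q} ∈ 𝓝 (φ x) := by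
      refine Filter.inter_mem (φ.open_target.mem_nhds (φ.map_source hxφ))
        ((φ.symm.continuousAt (φ.map_source hxφ)).preimage_mem_nhds ?_)
      rw [φ.left_inv hxφ, ← hxq]
      exact hloc' x
    rw [eφ, hx] at hc
    refine ⟨interior _, φ.symm, isOpen_interior, mem_interior_iff_mem_nhds.2 hc,
      φ.continuousOn_symm.mono (interior_subset.trans Set.inter_subset_left), fun y hy => ?_⟩
    refine ⟨?_, (interior_subset hy).2⟩
    rw [← eφ]
    exact φ.right_inv (interior_subset hy).1
  choose N s hNo hwN hsN hs using hsec
  -- The domain charts are shrunk until the section and all relations between `L`, `L'`, `g` and `m`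
  -- are valid throughout each piece.
  obtain ⟨𝒳, idx, α, β, hα, hβ, hmem, hβα, hloc, -⟩ := exists_refinement (𝒲 := 𝒲) (𝒵 := 𝒵) w L hL hLπ
    (fun q => {x | x ∈ (L q).source ∧ h.lift x ∈ N q ∧ ε.lift x ∈ (g q).source ∧
      f.lift (ε.lift x) ∈ (m q).source ∧ f.Maps (g q) (ε.lift x) (m q) ∧
      g q (ε.lift x) = δ.lift (L q x) ∧ L' q (h.lift x) = k.lift (L q x)})
    (fun q => Filter.inter_mem ((L q).open_source.mem_nhds (hwL q)) (Filter.inter_mem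
      (h.continuous_lift.continuousAt.preimage_mem_nhds ((hNo q).mem_nhds (hwN q))) (hev q)))
    (fun q x hx => hx.1) (fun q => ⟨q, hw q⟩)
  have hψ : Continuous fun x => s (idx x) (h.lift (α.lift x)) := by
    refine continuous_iff_continuousAt.2 fun x => ?_
    have hx := hmem x
    have h₁ : ContinuousAt (fun y => s (idx x) (h.lift (α.lift y))) x :=
      ContinuousAt.comp (f := fun y => h.lift (α.lift y))
        ((hsN (idx x)).continuousAt ((hNo _).mem_nhds hx.2.1))
        (h.continuous_lift.comp α.continuous_lift).continuousAt
    refine h₁.congr ?_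
    filter_upwards [hloc x] with y hy
    rw [hy]
  -- `j` is `h.comp α` lifted through `α'`, so it induces `h` by construction; the index bookkeeping
  -- is needed only for `k`.
  obtain ⟨j, ej, hj⟩ := exists_factorization (h.comp α) hα' hψ
    (funext fun x => (hs _ _ (hmem x).2.1).1)
  have hjα : ∀ x, α'.lift (j.lift x) = h.lift (α.lift x) := congrFun hj.2.1
  have hji : ∀ x, idx' (j.lift x) = Sum.inl (idx x) := fun x => by
    rw [ej]
    exact (hs _ _ (hmem x).2.1).2
  refine ⟨𝒳, 𝒳', α, β, α', β', j, hα, hβ, hα', hβ', hj.symm,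
    equiv_of_comp_equiv hδ' (funext fun x => ?_) ?_⟩
  · show k.lift (β.lift x) = β'.lift (j.lift x)
    rw [hβα', hβα, hji, hjα, Sum.elim_inl]
    exact (hmem x).2.2.2.2.2.2.symm
  have hA : (f.comp (ε.comp α)).Equiv ((ε'.comp α').comp j) :=
    ((comp_assoc_equiv f ε α).symm.trans (comp_equiv hh (.refl α))).trans
      ((comp_assoc_equiv ε' h α).trans
        ((comp_equiv (.refl ε') hj.symm).trans (comp_assoc_equiv ε' α' j).symm))
  -- The passage from the `h`-side to the `k`-side: on the piece `q`, the pair `(g q, m q)` carries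
  -- `ε ∘ α` to `δ ∘ β` and `ε' ∘ α'` to `δ' ∘ β'`.
  have hB : (f.comp (δ.comp β)).Equiv ((δ'.comp β').comp j) := by
    refine comp_equiv_of_natural (hδ.comp hβ) (hδ'.comp hβ') hA fun x => ?_
    obtain ⟨-, -, h₁, h₂, h₃, -, -⟩ := hmem x
    refine ⟨g (idx x), hg _, m (idx x), hm _, h₁, h₂, h₃, ?_, ?_⟩
    · filter_upwards [hloc x] with y hy
      show g (idx x) (ε.lift (α.lift y)) = δ.lift (β.lift y)
      rw [hβα, ← hy]
      exact (hmem y).2.2.2.2.2.1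
    · filter_upwards [hloc' (j.lift x)] with y hy
      show m (idx x) (ε'.lift (α'.lift y)) = δ'.lift (β'.lift y)
      have hy' := hmem' y
      rw [hy, hji] at hy'
      rw [hβα', hy, hji]
      exact hmδ _ _ hy'
  exact ((comp_assoc_equiv δ' k β).symm.trans (comp_equiv hk.symm (.refl β))).trans
    ((comp_assoc_equiv f δ β).trans (hB.trans (comp_assoc_equiv δ' β' j)))

end OrbifoldMapRep

/-! ### Passage to equivalence classes of representatives, and the equivalence relation. -/

theorem OrbMap.comp_assoc {n₁ n₂ n₃ n₄ : ℕ} {Q₁ Q₂ Q₃ Q₄ : Type u} [TopologicalSpace Q₁]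
    [TopologicalSpace Q₂] [TopologicalSpace Q₃] [TopologicalSpace Q₄]
    {𝒰₁ : OrbifoldStructure n₁ Q₁} {𝒰₂ : OrbifoldStructure n₂ Q₂} {𝒰₃ : OrbifoldStructure n₃ Q₃}
    {𝒰₄ : OrbifoldStructure n₄ Q₄} {𝒱₁ : OrbifoldAtlas 𝒰₁} {𝒱₂ : OrbifoldAtlas 𝒰₂}
    {𝒱₃ : OrbifoldAtlas 𝒰₃} {𝒱₄ : OrbifoldAtlas 𝒰₄} (k : OrbMap 𝒱₃ 𝒱₄) (g : OrbMap 𝒱₂ 𝒱₃)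
    (f : OrbMap 𝒱₁ 𝒱₂) : (k.comp g).comp f = k.comp (g.comp f) := by
  induction k using Quotient.inductionOn
  induction g using Quotient.inductionOn
  induction f using Quotient.inductionOn
  exact Quotient.sound (OrbifoldMapRep.comp_assoc_equiv _ _ _)

namespace ChartedOrbifoldMap

variable {n n' : ℕ} {Q Q' : Type u} [TopologicalSpace Q] [TopologicalSpace Q']
  {𝒰 : OrbifoldStructure n Q} {𝒰' : OrbifoldStructure n' Q'}

theorem Related.refl (f : ChartedOrbifoldMap 𝒰 𝒰') : f.Related f := by
  obtain ⟨ε, hε, eε⟩ := OrbifoldMapRep.exists_isLiftOfId (𝒱 := f.domAtlas) (𝒲 := f.domAtlas)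
    (ψ := id) (Diffeomorph.refl (𝓡 n) f.domAtlas.Total ∞).isLocalDiffeomorph fun _ => rfl
  obtain ⟨ε', hε', eε'⟩ := OrbifoldMapRep.exists_isLiftOfId (𝒱 := f.rangeAtlas)
    (𝒲 := f.rangeAtlas) (ψ := id)
    (Diffeomorph.refl (𝓡 n') f.rangeAtlas.Total ∞).isLocalDiffeomorph fun _ => rfl
  have h : f.map.comp ⟦ε⟧ = OrbMap.comp ⟦ε'⟧ f.map := by
    induction f.map using Quotient.inductionOn with | _ F => ?_
    refine Quotient.sound (OrbifoldMapRep.equiv_of_maps ?_ fun l hl x hx => ?_)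
    · show F.lift ∘ ε.lift = ε'.lift ∘ F.lift
      rw [eε, eε']
      rfl
    · obtain ⟨m, hm, hxm, hlm⟩ := F.exists_maps hl hx
      -- Conjugation by the identity fixes every germ, so both composites send `l` to the image `m`
      -- of `l` under `F`.
      refine ⟨m, OrbifoldMapRep.maps_comp_iff.2 ⟨l, hε.maps hl hx ?_, ?_⟩,
        OrbifoldMapRep.maps_comp_iff.2 ⟨m, hlm, hε'.maps hm hxm ?_⟩⟩
      · rw [eε]; rfl
      · rw [eε]; exact hlm
      · rw [eε']; rfl
  exact ⟨f.domAtlas, f.rangeAtlas, ⟦ε⟧, ⟦ε⟧, ⟦ε'⟧, ⟦ε'⟧, f.map, hε, hε, hε', hε', h, h⟩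

theorem Related.symm {f₁ f₂ : ChartedOrbifoldMap 𝒰 𝒰'} (h : f₁.Related f₂) : f₂.Related f₁ := by
  obtain ⟨𝒲, 𝒲', ε₁, ε₂, ε₁', ε₂', k, h₁, h₂, h₁', h₂', e₁, e₂⟩ := h
  exact ⟨𝒲, 𝒲', ε₂, ε₁, ε₂', ε₁', k, h₂, h₁, h₂', h₁', e₂, e₁⟩

end ChartedOrbifoldMap

theorem OrbMap.IsLiftOfId.comp {n : ℕ} {Q : Type u} [TopologicalSpace Q]
    {𝒰 : OrbifoldStructure n Q} {𝒱 𝒲 𝒳 : OrbifoldAtlas 𝒰} {δ : OrbMap 𝒲 𝒳} {ε : OrbMap 𝒱 𝒲}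
    (hδ : δ.IsLiftOfId) (hε : ε.IsLiftOfId) : (δ.comp ε).IsLiftOfId := by
  induction δ using Quotient.inductionOn
  induction ε using Quotient.inductionOn
  exact OrbifoldMapRep.IsLiftOfId.comp hδ hε

/-- Two maps which are induced from `f` along lifts of the identity induce a common map. -/
theorem OrbMap.exists_common_refinement {n n' : ℕ} {Q Q' : Type u} [TopologicalSpace Q]
    [TopologicalSpace Q'] {𝒰 : OrbifoldStructure n Q} {𝒰' : OrbifoldStructure n' Q'}
    {𝒱 𝒲 𝒵 : OrbifoldAtlas 𝒰} {𝒱' 𝒲' 𝒵' : OrbifoldAtlas 𝒰'}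
    {f : OrbMap 𝒱 𝒱'} {h : OrbMap 𝒲 𝒲'} {k : OrbMap 𝒵 𝒵'} {ε : OrbMap 𝒲 𝒱} {ε' : OrbMap 𝒲' 𝒱'}
    {δ : OrbMap 𝒵 𝒱} {δ' : OrbMap 𝒵' 𝒱'} (hε : ε.IsLiftOfId) (hε' : ε'.IsLiftOfId)
    (hδ : δ.IsLiftOfId) (hδ' : δ'.IsLiftOfId) (hh : f.comp ε = ε'.comp h)
    (hk : f.comp δ = δ'.comp k) :
    ∃ (𝒳 : OrbifoldAtlas 𝒰) (𝒳' : OrbifoldAtlas 𝒰') (α : OrbMap 𝒳 𝒲) (β : OrbMap 𝒳 𝒵)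
      (α' : OrbMap 𝒳' 𝒲') (β' : OrbMap 𝒳' 𝒵') (j : OrbMap 𝒳 𝒳'), α.IsLiftOfId ∧ β.IsLiftOfId ∧
      α'.IsLiftOfId ∧ β'.IsLiftOfId ∧ h.comp α = α'.comp j ∧ k.comp β = β'.comp j := by
  induction f using Quotient.inductionOn
  induction h using Quotient.inductionOn
  induction k using Quotient.inductionOn
  induction ε using Quotient.inductionOn
  induction ε' using Quotient.inductionOn
  induction δ using Quotient.inductionOn
  induction δ' using Quotient.inductionOn
  obtain ⟨𝒳, 𝒳', α, β, α', β', j, hα, hβ, hα', hβ', e₁, e₂⟩ :=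
    OrbifoldMapRep.exists_common_refinement hε hε' hδ hδ' (Quotient.exact hh) (Quotient.exact hk)
  exact ⟨𝒳, 𝒳', ⟦α⟧, ⟦β⟧, ⟦α'⟧, ⟦β'⟧, ⟦j⟧, hα, hβ, hα', hβ', Quotient.sound e₁, Quotient.sound e₂⟩

theorem ChartedOrbifoldMap.Related.trans {n n' : ℕ} {Q Q' : Type u} [TopologicalSpace Q]
    [TopologicalSpace Q'] {𝒰 : OrbifoldStructure n Q} {𝒰' : OrbifoldStructure n' Q'}
    {f₁ f₂ f₃ : ChartedOrbifoldMap 𝒰 𝒰'} (h : f₁.Related f₂) (h' : f₂.Related f₃) :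
    f₁.Related f₃ := by
  obtain ⟨𝒲, 𝒲', ε₁, ε₂, ε₁', ε₂', k, h₁, h₂, h₁', h₂', e₁, e₂⟩ := h
  obtain ⟨𝒵, 𝒵', δ₂, δ₃, δ₂', δ₃', l, k₂, k₃, k₂', k₃', d₂, d₃⟩ := h'
  obtain ⟨𝒳, 𝒳', α, β, α', β', j, hα, hβ, hα', hβ', a₁, a₂⟩ :=
    -- The common base is the middle map `f₂`, from which both `k` and `l` are induced.
    OrbMap.exists_common_refinement h₂ h₂' k₂ k₂' e₂ d₂
  refine ⟨𝒳, 𝒳', ε₁.comp α, δ₃.comp β, ε₁'.comp α', δ₃'.comp β', j, h₁.comp hα, k₃.comp hβ,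
    h₁'.comp hα', k₃'.comp hβ', ?_, ?_⟩
  · rw [← OrbMap.comp_assoc, e₁, OrbMap.comp_assoc, a₁, OrbMap.comp_assoc]
  · rw [← OrbMap.comp_assoc, d₃, OrbMap.comp_assoc, a₂, OrbMap.comp_assoc]

theorem mainTheorem4 {n n' : ℕ} {Q Q' : Type u} [TopologicalSpace Q] [TopologicalSpace Q']
    [T2Space Q] [SecondCountableTopology Q] [T2Space Q'] [SecondCountableTopology Q']
    (𝒰 : OrbifoldStructure n Q) (𝒰' : OrbifoldStructure n' Q') :
    Equivalence
      (ChartedOrbifoldMap.Related : ChartedOrbifoldMap 𝒰 𝒰' → ChartedOrbifoldMap 𝒰 𝒰' → Prop) :=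
  ⟨.refl, .symm, .trans⟩
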